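/- **Theorem (the elimination stack is linearizable).** *Object.* Fix a set $T$ of thread ids, a set $\mathit{Val}$ of values and a value $\mathtt{empty}\in \mathit{Val}$. The shared state consists of a pointer `top`, a heap of nodes (`val`, `next`), an array `location` indexed by $T$ holding NULL or a descriptor $(\mathit{op},\mathit{id},\mathit{input})$, and an array `collision` indexed by $\mathbb Z$ holding NULL or a thread id; initially everything is NULL and nothing is allocated. A descriptor $p$ is the triple of the method (push or pop), the id `mytid` of the invoking thread, and the input (of a push). Memory is garbage collected: `malloc` returns an arbitrary address that was never allocated before. Below, $x/y$ means $x$ in a push and $y$ in a pop, and a CAS is a single atomic step. Both methods repeat the following loop body forever, until a return: 1. One iteration of Treiber's stack. Push: `n = malloc(); n->val = p.input; oldTop = top; n->next = oldTop; if CAS(top, oldTop, n) return NULL`. Pop: `oldTop = top; if (oldTop == NULL) return empty; newTop = oldTop->next; if CAS(top, oldTop, newTop) return oldTop->val`. 2. If that CAS failed: `location[mytid] = p; pos = nondet(); do { him = collision[pos] } while (!CAS(collision[pos], him, mytid))`. 3. If `him != NULL`: `q = location[him]`; if moreover `q != NULL & q.id == him & p.op != q.op`, then: if `CAS(location[mytid],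 p, NULL)` succeeds, do the *second CAS* `CAS(location[him], q, p/NULL)`, and return `NULL/q.input` if it succeeds and restart the loop if it fails; if `CAS(location[mytid], p, NULL)` fails, do `val = NULL/location[mytid].input; location[mytid] = NULL; return val`. 4. If one of the tests of step 3 failed: if `CAS(location[mytid], p, NULL)` fails, do `val = NULL/location[mytid].input; location[mytid] = NULL; return val`; otherwise restart the loop. *Executions.* Each thread performs at most one invocation, prescribed by an arbitrary environment. An execution is a finite interleaving of invocations, returns and atomic steps (local tests and actions, accesses to a single shared location, and CASs) of the threads from the initial configuration; it is completed if every invoked thread has returned. Its trace is the sequence of its steps, labelled with thread ids. *Linearizability.* A trace $\tau$ of a completed execution is linearizable with respect to a set $S$ of sequences of operations $m(x)/r$ if there are a map $lp$ from threads to positions of $\tau$ and an enumeration $t_1,\dots,t_n$ without repetition of the threads invoked in $\tau$, such that $lp(t_1)\le\dots\le lp(t_n)$, each $lp(t_i)$ lies strictly between the invocation and the return of $t_i$ in $\tau$, and the sequence of the operations of $t_1,\dots,t_n$ belongs to $S$. Let $S$ be the specification of a sequential, initially empty LIFO stack, in which push returns NULL and a pop on the empty stack returns $\mathtt{empty}$.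 *Claim.* The elimination stack is linearizable with respect to $S$: every trace of a completed execution is linearizable. Moreover, for every completed execution, $lp$ and $t_1,\dots,t_n$ can be chosen such that * for each invoked thread $t$, the step at position $lp(t)$ is either a successful CAS of $t$ on `top`, or a read of `top` = NULL by $t$, where $t$ is a pop that returns $\mathtt{empty}$, or the successful second CAS of a collision in which $t$ takes part, i.e. it is performed by $t$ or it modifies `location[`$t$`]`; * conversely, if the step at position $k$ is a successful CAS of $t$ on `top`, then $lp(t)=k$; and if it is a successful second CAS, performed by $a$ with `him` $=b$, then $lp(a)=lp(b)=k$, one of $a,b$ is a push and the other is a pop, and in the linearization the push is immediately followed by that pop. -/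

import Mathlib

universe u v w

namespace KatObj

/-! ### Syntax: Boolean tests, KAT expressions with atomic read-writes and returns -/

/-- Boolean test expressions over primitive tests `B`. -/
inductive BExp (B : Type) : Type
  | prim (b : B)
  | and (b c : BExp B)
  | or (b c : BExp B)
  | not (b : BExp B)
  | zero
  | one

/-- Truth of a test expression, given the truth of the primitive tests. -/
def BExp.Holds {B : Type} (sem : B → Prop) : BExp B → Prop
  | .prim b => sem b
  | .and b c => b.Holds sem ∧ c.Holds sem
  | .or b c => b.Holds sem ∨ c.Holds sem
  | .not b => ¬ b.Holds sem
  | .zero => False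
  | .one => True

/-- KAT expressions over primitive actions `A`, primitive tests `B` and return expressions `E`.
`arw b a` is the atomic read-write: test `b` and do `a` with no interleaving in between. -/
inductive Kat (A B E : Type) : Type
  | act (a : A)
  | test (b : BExp B)
  | arw (b : BExp B) (a : A)
  | ret (e : E)
  | seq (k k' : Kat A B E)
  | plus (k k' : Kat A B E)
  | star (k : Kat A B E)
  | zero
  | one

infixr:67 " ⬝ " => Kat.seq
infixr:65 " ⊹ " => Kat.plus

/-- A concurrent object for threads `T`: method names with argument types, a KAT implementation of
each method, and the meaning of the primitive symbols on local states `Lo` and shared states `Gl`.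
Actions are relations, since allocation and `nondet()` are nondeterministic. The initial local
state of an invocation may depend on the thread id, which is treated as an additional input. -/
structure ConcObject (T : Type u) : Type (max u (v + 1) (w + 1)) where
  Meth : Type
  Arg : Meth → Type v
  Ret : Type v
  Act : Type
  Test : Type
  RetExp : Type
  Lo : Type w
  Gl : Type w
  actSem : Act → Lo → Gl → Lo → Gl → Prop
  testSem : Test → Lo → Gl → Prop
  retSem : RetExp → Lo → Ret
  initGl : Gl
  initLo : T → (m : Meth) → Arg m → Lo
  code : Meth → Kat Act Test RetExp

/-! ### Operational semantics -/

section Semantics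

variable {T : Type u} (O : ConcObject.{u, v, w} T)

/-- Code of the object. -/
abbrev ConcObject.Code : Type := Kat O.Act O.Test O.RetExp

/-- Labels: invocations, returns, actions, tests and atomic read-writes. -/
inductive Label : Type v
  | inv (m : O.Meth) (x : O.Arg m)
  | ret (r : O.Ret)
  | act (a : O.Act)
  | test (b : BExp O.Test)
  | arw (b : BExp O.Test) (a : O.Act)

/-- A step of one thread, with an optional label. The resulting code is `none` (written `⊥` on
paper) once the thread has returned. -/
inductive Step : O.Lo → O.Gl → O.Code → Option (Label O) → O.Lo → O.Gl → Option O.Code → Prop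
  | act {l g a l' g'} (h : O.actSem a l g l' g') :
      Step l g (.act a) (some (.act a)) l' g' (some .one)
  | test {l g b} (h : b.Holds fun c => O.testSem c l g) :
      Step l g (.test b) (some (.test b)) l g (some .one)
  | arw {l g b a l' g'} (hb : b.Holds fun c => O.testSem c l g) (ha : O.actSem a l g l' g') :
      Step l g (.arw b a) (some (.arw b a)) l' g' (some .one)
  | ret {l g e} : Step l g (.ret e) (some (.ret (O.retSem e l))) l g none
  | plusLeft {l g k k'} : Step l g (.plus k k') none l g (some k)
  | plusRight {l g k k'} : Step l g (.plus k k') none l g (some k')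
  | starUnfold {l g k} : Step l g (.star k) none l g (some (.seq k (.star k)))
  | starExit {l g k} : Step l g (.star k) none l g (some .one)
  | seqOne {l g k} : Step l g (.seq .one k) none l g (some k)
  | seqStep {l g k k' ℓ l' g' k₁} (h : Step l g k ℓ l' g' (some k₁)) :
      Step l g (.seq k k') ℓ l' g' (some (.seq k₁ k'))
  | seqRet {l g k k' ℓ l' g'} (h : Step l g k ℓ l' g' none) :
      Step l g (.seq k k') ℓ l' g' none

/-- Finitely many unlabelled steps followed by one labelled step. -/
inductive BigStep : O.Lo → O.Gl → O.Code → Label O → O.Lo → O.Gl → Option O.Code → Prop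
  | last {l g k ℓ l' g' k'} (h : Step O l g k (some ℓ) l' g' k') : BigStep l g k ℓ l' g' k'
  | silent {l g k l₁ g₁ k₁ ℓ l' g' k'} (h : Step O l g k none l₁ g₁ (some k₁))
      (h' : BigStep l₁ g₁ k₁ ℓ l' g' k') : BigStep l g k ℓ l' g' k'

/-- A configuration: the shared state and, for each thread invoked so far, its local state and the
code it still has to run. -/
structure Config where
  gl : O.Gl
  thr : T → Option (O.Lo × Option O.Code)

/-- The initial configuration: no thread has been invoked. -/
def Config.init : Config O := ⟨O.initGl, fun _ => none⟩

/-- Every invoked thread has returned. -/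
def Config.Final {O : ConcObject.{u, v, w} T} (C : Config O) : Prop :=
  ∀ t l k, C.thr t = some (l, k) → k = none

/-- An environment says which threads invoke which method with which arguments, one invocation
per thread. It need not be finite: an execution is finite and so involves finitely many threads. -/
abbrev Env : Type (max u v) := T → Option ((m : O.Meth) × O.Arg m)

/-- Transitions between configurations, labelled with a thread and a label. -/
inductive Trans [DecidableEq T] (env : Env O) : Config O → T × Label O → Config O → Prop
  | inv {C : Config O} {t m x} (he : env t = some ⟨m, x⟩) (ht : C.thr t = none) :
      Trans env C (t, .inv m x)
        ⟨C.gl, Function.update C.thr t (some (O.initLo t m x, some (O.code m)))⟩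
  | step {C : Config O} {t l k ℓ l' g' k'} (ht : C.thr t = some (l, some k))
      (h : BigStep O l C.gl k ℓ l' g' k') :
      Trans env C (t, ℓ) ⟨g', Function.update C.thr t (some (l', k'))⟩

/-- An execution `C₀ ⇒ C₁ ⇒ ⋯ ⇒ Cₙ` from the initial configuration, where `n` is the length of its
trace (`conf i` is irrelevant for `i > n`). -/
structure Execution [DecidableEq T] (env : Env O) where
  trace : List (T × Label O)
  conf : ℕ → Config O
  init : conf 0 = Config.init O
  step : ∀ (i : ℕ) (h : i < trace.length), Trans O env (conf i) (trace)[i] (conf (i + 1))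

/-- The execution ends in a final configuration. -/
def Execution.Completed [DecidableEq T] {O : ConcObject.{u, v, w} T} {env : Env O}
    (ρ : Execution O env) : Prop :=
  (ρ.conf ρ.trace.length).Final

/-- The semantics of an object: traces of completed executions under all environments. -/
def ConcObject.traces [DecidableEq T] : Set (List (T × Label O)) :=
  {τ | ∃ (env : Env O) (ρ : Execution O env), ρ.Completed ∧ ρ.trace = τ}

end Semantics

/-! ### Linearizability -/

/-- An operation symbol `m(x)/r`. -/
structure OpSym (Meth : Type) (Arg : Meth → Type v) (Ret : Type v) where
  meth : Meth
  arg : Arg meth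
  ret : Ret

section Linearizability

variable {T : Type u} {O : ConcObject.{u, v, w} T}

/-- `o` is the operation performed by thread `t` in the trace `τ`. -/
def OperationOf (τ : List (T × Label O)) (t : T) (o : OpSym O.Meth O.Arg O.Ret) : Prop :=
  (t, Label.inv o.meth o.arg) ∈ τ ∧ (t, Label.ret o.ret) ∈ τ

/-- `lp` maps threads to positions of their linearization points in `τ`, and `ts` lists the invoked
threads in a linearization order induced by `lp`, whose operations form a sequence in `S`. Two
threads may be linearized at the same position; `ts` then fixes their order. -/
structure IsLinearization (S : Set (List (OpSym O.Meth O.Arg O.Ret))) (τ : List (T × Label O))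
    (lp : T → ℕ) (ts : List T) : Prop where
  nodup : ts.Nodup
  mem_iff : ∀ t, t ∈ ts ↔ ∃ m x, (t, Label.inv m x) ∈ τ
  sorted : ts.Pairwise fun s t => lp s ≤ lp t
  between : ∀ t ∈ ts, ∃ i j m x r, i < lp t ∧ lp t < j ∧
    τ[i]? = some (t, Label.inv m x) ∧ τ[j]? = some (t, Label.ret r)
  spec : ∃ os ∈ S, List.Forall₂ (OperationOf τ) ts os

/-- A trace is linearizable with respect to the sequential specification `S`. -/
def LinearizableTrace (S : Set (List (OpSym O.Meth O.Arg O.Ret))) (τ : List (T × Label O)) : Prop :=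
  ∃ lp ts, IsLinearization S τ lp ts

/-- An object is linearizable with respect to `S` if all its traces are. -/
def Linearizable [DecidableEq T] (O : ConcObject.{u, v, w} T)
    (S : Set (List (OpSym O.Meth O.Arg O.Ret))) : Prop :=
  ∀ τ ∈ O.traces, LinearizableTrace S τ

end Linearizability

/-! ### The sequential stack -/

inductive StackMeth : Type
  | push
  | pop

/-- `push` takes a value, `pop` takes nothing. -/
def StackArg (Val : Type v) : StackMeth → Type v
  | .push => Val
  | .pop => PUnit

/-- Operation symbols of a stack; `push` returns `none` (NULL) and `pop` returns `some v`. -/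
abbrev StackOp (Val : Type v) : Type v := OpSym StackMeth (StackArg Val) (Option Val)

/-- The operations can be executed one after the other from the stack `s` (top first). A `pop` on
the empty stack leaves it empty and returns `empty`. -/
def StackRun {Val : Type v} (empty : Val) : List Val → List (StackOp Val) → Prop
  | _, [] => True
  | s, ⟨.push, x, r⟩ :: os => r = none ∧ StackRun empty ((x : Val) :: s) os
  | [], ⟨.pop, _, r⟩ :: os => r = some empty ∧ StackRun empty [] os
  | y :: s, ⟨.pop, _, r⟩ :: os => r = some y ∧ StackRun empty s os

/-- The sequential specification of an initially empty stack. -/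
def stackSpec {Val : Type v} (empty : Val) : Set (List (StackOp Val)) :=
  {os | StackRun empty [] os}

/-! ### The elimination stack -/

/-- A descriptor `(op, id, input)`; `input` is `none` for a pop. -/
structure Desc (T : Type u) (Val : Type v) where
  op : StackMeth
  id : T
  input : Option Val

/-- A list node; pointers are optional addresses, `none` being NULL. -/
structure Node (Val : Type v) where
  val : Option Val
  next : Option ℕ

/-- Shared state. `heap a = none` means that the address `a` was never allocated. -/
structure Shared (T : Type u) (Val : Type v) where
  top : Option ℕ
  heap : ℕ → Option (Node Val)
  location : T → Option (Desc T Val)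
  collision : ℤ → Option T

/-- Local variables of an invocation. -/
structure Locals (T : Type u) (Val : Type v) where
  mytid : T
  p : Desc T Val
  n : Option ℕ
  oldTop : Option ℕ
  newTop : Option ℕ
  pos : ℤ
  him : Option T
  q : Option (Desc T Val)
  val : Option Val

/-- Primitive actions. Below, `x/y` means `x` for a push and `y` for a pop. -/
inductive SAct : Type
  | malloc -- n = malloc(...)
  | setVal -- n->val = p.input
  | readTop -- oldTop = top
  | setNext -- n->next = oldTop
  | topToN -- top = n
  | readNext -- newTop = oldTop->next
  | topToNew -- top = newTop
  | readVal -- val = oldTop->val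
  | publish -- location[mytid] = p
  | choosePos -- pos = nondet()
  | readCollision -- him = collision[pos]
  | setCollision -- collision[pos] = mytid
  | readHim -- q = location[him]
  | clearMine -- location[mytid] = NULL
  | setHim -- location[him] = p/NULL
  | readMine -- val = NULL/location[mytid].input

/-- Primitive tests. -/
inductive STest : Type
  | topEqOld -- top == oldTop
  | oldTopNull -- oldTop == NULL
  | collisionEqHim -- collision[pos] == him
  | himNull -- him == NULL
  | qNull -- q == NULL
  | qIdHim -- q.id == him
  | opDiff -- p.op != q.op
  | mineEqP -- location[mytid] == p
  | himEqQ -- location[him] == q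

/-- Return expressions. -/
inductive SRet : Type
  | null -- NULL
  | empty -- the value that signals an empty stack
  | val -- val
  | matched -- NULL/q.input

section ElimStack

variable {T : Type u} {Val : Type v} [DecidableEq T]

/-- The node a pointer points to, if any. -/
def Shared.deref (g : Shared T Val) (ptr : Option ℕ) : Option (Node Val) := ptr.bind g.heap

/-- Modify the node that a pointer points to. -/
def Shared.modifyNode (g : Shared T Val) (ptr : Option ℕ) (f : Node Val → Node Val) :
    Shared T Val :=
  match ptr with
  | none => g
  | some a => { g with heap := Function.update g.heap a ((g.heap a).map f) }

/-- `x/y`: the first alternative in a push, the second in a pop. -/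
def Locals.pushPop {α : Type*} (l : Locals T Val) (x y : α) : α :=
  match l.p.op with
  | .push => x
  | .pop => y

/-- Meaning of the actions. Memory is garbage collected: an allocation takes an arbitrary address
that was never allocated before, with arbitrary initial contents. -/
def sActSem : SAct → Locals T Val → Shared T Val → Locals T Val → Shared T Val → Prop
  | .malloc, l, g, l', g' => ∃ a node, g.heap a = none ∧
      l' = { l with n := some a } ∧ g' = { g with heap := Function.update g.heap a (some node) }
  | .setVal, l, g, l', g' =>
      l' = l ∧ g' = g.modifyNode l.n fun d => { d with val := l.p.input }
  | .readTop, l, g, l', g' => l' = { l with oldTop := g.top } ∧ g' = g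
  | .setNext, l, g, l', g' =>
      l' = l ∧ g' = g.modifyNode l.n fun d => { d with next := l.oldTop }
  | .topToN, l, g, l', g' => l' = l ∧ g' = { g with top := l.n }
  | .readNext, l, g, l', g' =>
      l' = { l with newTop := (g.deref l.oldTop).bind Node.next } ∧ g' = g
  | .topToNew, l, g, l', g' => l' = l ∧ g' = { g with top := l.newTop }
  | .readVal, l, g, l', g' =>
      l' = { l with val := (g.deref l.oldTop).bind Node.val } ∧ g' = g
  | .publish, l, g, l', g' =>
      l' = l ∧ g' = { g with location := Function.update g.location l.mytid (some l.p) }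
  | .choosePos, l, g, l', g' => (∃ i : ℤ, l' = { l with pos := i }) ∧ g' = g
  | .readCollision, l, g, l', g' => l' = { l with him := g.collision l.pos } ∧ g' = g
  | .setCollision, l, g, l', g' =>
      l' = l ∧ g' = { g with collision := Function.update g.collision l.pos (some l.mytid) }
  | .readHim, l, g, l', g' => l' = { l with q := l.him.bind g.location } ∧ g' = g
  | .clearMine, l, g, l', g' =>
      l' = l ∧ g' = { g with location := Function.update g.location l.mytid none }
  | .setHim, l, g, l', g' => l' = l ∧ ∃ h, l.him = some h ∧
      g' = { g with location := Function.update g.location h (l.pushPop (some l.p) none) }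
  | .readMine, l, g, l', g' =>
      l' = { l with val := l.pushPop none ((g.location l.mytid).bind Desc.input) } ∧ g' = g

/-- Meaning of the tests. -/
def sTestSem : STest → Locals T Val → Shared T Val → Prop
  | .topEqOld, l, g => g.top = l.oldTop
  | .oldTopNull, l, _ => l.oldTop = none
  | .collisionEqHim, l, g => g.collision l.pos = l.him
  | .himNull, l, _ => l.him = none
  | .qNull, l, _ => l.q = none
  | .qIdHim, l, _ => ∃ d, l.q = some d ∧ l.him = some d.id
  | .opDiff, l, _ => ∃ d, l.q = some d ∧ l.p.op ≠ d.op
  | .mineEqP, l, g => g.location l.mytid = some l.p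
  | .himEqQ, l, g => l.him.bind g.location = l.q

/-- Meaning of the return expressions. -/
def sRetSem (empty : Val) : SRet → Locals T Val → Option Val
  | .null, _ => none
  | .empty, _ => some empty
  | .val, l => l.val
  | .matched, l => l.pushPop none (l.q.bind Desc.input)

abbrev SCode : Type := Kat SAct STest SRet

/-- One iteration of the loop of Treiber's stack. -/
def treiberIter : StackMeth → SCode
  | .push =>
    .act .malloc ⬝ .act .setVal ⬝ .act .readTop ⬝ .act .setNext ⬝
      (.arw (.prim .topEqOld) .topToN ⬝ .ret .null ⊹
       .test (.not (.prim .topEqOld)))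
  | .pop =>
    .act .readTop ⬝
      (.test (.prim .oldTopNull) ⬝ .ret .empty ⊹
       .test (.not (.prim .oldTopNull)) ⬝ .act .readNext ⬝
         (.arw (.prim .topEqOld) .topToNew ⬝ .act .readVal ⬝ .ret .val ⊹
          .test (.not (.prim .topEqOld))))

/-- `val = NULL/location[mytid].input; location[mytid] = NULL; return val` -/
def finishCode : SCode := .act .readMine ⬝ .act .clearMine ⬝ .ret .val

/-- `if (!CAS(&location[mytid], p, NULL)) { finish }` -/
def clearCode : SCode :=
  .arw (.prim .mineEqP) .clearMine ⊹
  .test (.not (.prim .mineEqP)) ⬝ finishCode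

/-- `do { him = collision[pos] } while (!CAS(&collision[pos], him, mytid))` -/
def announceCode : SCode :=
  .act .readCollision ⬝
    .star (.test (.not (.prim .collisionEqHim)) ⬝ .act .readCollision) ⬝
    .arw (.prim .collisionEqHim) .setCollision

/-- `q != NULL & q.id = him & p.op != q.op` -/
def canCollide : BExp STest := .and (.not (.prim .qNull)) (.and (.prim .qIdHim) (.prim .opDiff))

/-- The two CASs of the initiator of a collision. -/
def collideCode : SCode :=
  .arw (.prim .mineEqP) .clearMine ⬝
    (.arw (.prim .himEqQ) .setHim ⬝ .ret .matched ⊹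
     .test (.not (.prim .himEqQ))) ⊹
  .test (.not (.prim .mineEqP)) ⬝ finishCode

/-- The collision protocol that follows a failed iteration of Treiber's stack. -/
def eliminationIter : SCode :=
  .act .publish ⬝ .act .choosePos ⬝ announceCode ⬝
    (.test (.not (.prim .himNull)) ⬝ .act .readHim ⬝
       (.test canCollide ⬝ collideCode ⊹
        .test (.not canCollide) ⬝ clearCode) ⊹
     .test (.prim .himNull) ⬝ clearCode)

/-- The elimination stack, with `empty` the value returned by a pop that finds the stack empty. -/
def elimStack (T : Type u) {Val : Type v} [DecidableEq T] (empty : Val) :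
    ConcObject.{u, v, max u v} T where
  Meth := StackMeth
  Arg := StackArg Val
  Ret := Option Val
  Act := SAct
  Test := STest
  RetExp := SRet
  Lo := Locals T Val
  Gl := Shared T Val
  actSem := sActSem
  testSem := sTestSem
  retSem := sRetSem empty
  initGl := ⟨none, fun _ => none, fun _ => none, fun _ => none⟩
  initLo t m x :=
    { mytid := t
      p := ⟨m, t, match m, x with
        | .push, x => some x
        | .pop, _ => none⟩
      n := none, oldTop := none, newTop := none, pos := 0, him := none, q := none, val := none }
  code m := .star (treiberIter m ⬝ eliminationIter)

/-! ### Linearization points of the elimination stack -/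

variable {empty : Val} {env : Env (elimStack T empty)}

/-- The `k`-th step is a successful CAS on `top` by thread `t`. -/
def TopCASAt (ρ : Execution (elimStack T empty) env) (k : ℕ) (t : T) : Prop :=
  ρ.trace[k]? = some (t, Label.arw (.prim STest.topEqOld) SAct.topToN) ∨
  ρ.trace[k]? = some (t, Label.arw (.prim STest.topEqOld) SAct.topToNew)

/-- Thread `t` performs a pop that returns `empty`, and the `k`-th step is its read of NULL from
`top`. -/
def EmptyReadAt (ρ : Execution (elimStack T empty) env) (k : ℕ) (t : T) : Prop :=
  OperationOf ρ.trace t ⟨StackMeth.pop, PUnit.unit, some empty⟩ ∧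
  ρ.trace[k]? = some (t, Label.act SAct.readTop) ∧ (ρ.conf k).gl.top = none

/-- The `k`-th step is the successful second CAS of a collision in which `a` is the initiator
(active) and `b` is the thread whose `location` cell is modified (passive). -/
def CollisionAt (ρ : Execution (elimStack T empty) env) (k : ℕ) (a b : T) : Prop :=
  ρ.trace[k]? = some (a, Label.arw (.prim STest.himEqQ) SAct.setHim) ∧
  ∃ l c, (ρ.conf k).thr a = some (l, c) ∧ l.him = some b

/-- Thread `t` invokes the method `m` in `ρ`. -/
def Invokes (ρ : Execution (elimStack T empty) env) (t : T) (m : StackMeth) : Prop :=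
  ∃ x, (t, Label.inv m x) ∈ ρ.trace

/-- The linearization points are exactly the successful CASs on `top`, the reads of an empty `top`
and the successful second CASs of collisions; each collision linearizes both of its threads, one a
push and the other a pop, the push immediately followed by the pop. -/
structure HasElimLinPoints (ρ : Execution (elimStack T empty) env) (lp : T → ℕ) (ts : List T) :
    Prop where
  cases : ∀ t ∈ ts, TopCASAt ρ (lp t) t ∨ EmptyReadAt ρ (lp t) t ∨
    ∃ a b, CollisionAt ρ (lp t) a b ∧ (t = a ∨ t = b)
  topCAS : ∀ k t, TopCASAt ρ k t → lp t = k
  collision : ∀ k a b, CollisionAt ρ k a b → lp a = k ∧ lp b = k ∧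
    ∃ s t, (s = a ∧ t = b ∨ s = b ∧ t = a) ∧ Invokes ρ s .push ∧ Invokes ρ t .pop ∧
      ∃ ts₁ ts₂, ts = ts₁ ++ s :: t :: ts₂

end ElimStack

end KatObj

/-!
The linearization order is recorded in an auxiliary history while the execution runs: a successful
CAS on `top` and a read of NULL from `top` by a pop append the thread that performs them, and a
successful second CAS of a collision appends the push and then the pop. A push that is immediately
followed by a pop of the pushed value leaves the stack unchanged, so the linked list at `top`, whose
public nodes are never modified, always holds the state reached by the recorded operations.

A passive party of a collision is linearized by another thread, and `location[t]` tells `t` whether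
this has happened. While `t` finds its own descriptor there, it has not been linearized. It is
replaced only by a thread that collides with `t`, with the very value that `t` then returns:
the descriptor of the push if `t` pops, and NULL if `t` pushes. Since `t` leaves this cell empty
before it attempts the second CAS, nobody can linearize `t` while it tries to linearize a partner.
-/

namespace KatObj

section Executions

variable {T : Type u} {O : ConcObject.{u, v, w} T}

theorem Step.label_of_none {l l' : O.Lo} {g g' : O.Gl} {k : O.Code} {ℓ : Option (Label O)}
    {k' : Option O.Code} (h : Step O l g k ℓ l' g' k') (hk' : k' = none) :
    ∃ r, ℓ = some (.ret r) := by
  induction h with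
  | ret => exact ⟨_, rfl⟩
  | seqRet _ ih => exact ih rfl
  | _ => cases hk'

theorem BigStep.label_of_none {l l' : O.Lo} {g g' : O.Gl} {k : O.Code} {ℓ : Label O}
    {k' : Option O.Code} (h : BigStep O l g k ℓ l' g' k') (hk' : k' = none) :
    ∃ r, ℓ = .ret r := by
  induction h with
  | last h =>
    obtain ⟨r, hr⟩ := h.label_of_none hk'
    exact ⟨r, Option.some.inj hr⟩
  | silent _ _ ih => exact ih hk'

variable [DecidableEq T] {env : Env O} {C C' : Config O} {t u : T} {ℓ : Label O}

theorem Trans.thr_of_ne (h : Trans O env C (t, ℓ) C') (hu : u ≠ t) : C'.thr u = C.thr u := by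
  cases h <;> exact Function.update_of_ne hu ..

theorem Trans.thr_self (h : Trans O env C (t, ℓ) C') :
    ∃ l k, C'.thr t = some (l, k) ∧ (k = none → ∃ r, ℓ = .ret r) ∧
      (C.thr t = none → ∃ m x, env t = some ⟨m, x⟩ ∧ ℓ = .inv m x) := by
  cases h with
  | inv he _ =>
    exact ⟨_, _, Function.update_self .., (fun h => by cases h), fun _ => ⟨_, _, he, rfl⟩⟩
  | step ht hb =>
    exact ⟨_, _, Function.update_self .., hb.label_of_none, fun h => by cases ht.symm.trans h⟩

theorem Trans.thr_ne_none (h : Trans O env C (t, ℓ) C') (hu : C.thr u ≠ none) :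
    C'.thr u ≠ none := by
  by_cases hut : u = t
  · obtain ⟨l, k, hk, -⟩ := h.thr_self
    simp [hut, hk]
  · rwa [h.thr_of_ne hut]

namespace Execution

variable (ρ : Execution O env) {i j : ℕ}

theorem trans_of_getElem? (h : ρ.trace[i]? = some (t, ℓ)) :
    Trans O env (ρ.conf i) (t, ℓ) (ρ.conf (i + 1)) := by
  obtain ⟨hi, h⟩ := List.getElem?_eq_some_iff.1 h
  exact h ▸ ρ.step i hi

theorem exists_trans (hi : i < ρ.trace.length) :
    ∃ t ℓ, ρ.trace[i]? = some (t, ℓ) ∧ Trans O env (ρ.conf i) (t, ℓ) (ρ.conf (i + 1)) :=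
  have h := List.getElem?_eq_getElem hi
  ⟨_, _, h, ρ.trans_of_getElem? h⟩

theorem thr_ne_none_mono (hij : i ≤ j) (hj : j ≤ ρ.trace.length) (h : (ρ.conf i).thr t ≠ none) :
    (ρ.conf j).thr t ≠ none := by
  induction j, hij using Nat.le_induction with
  | base => exact h
  | succ j _ ih =>
    obtain ⟨_, _, -, htr⟩ := ρ.exists_trans hj
    exact htr.thr_ne_none (ih (Nat.le_of_succ_le hj))

theorem thr_ne_none_of_getElem? (hi : ρ.trace[i]? = some (t, ℓ)) (hij : i < j)
    (hj : j ≤ ρ.trace.length) : (ρ.conf j).thr t ≠ none := by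
  obtain ⟨l, k, hk, -⟩ := (ρ.trans_of_getElem? hi).thr_self
  exact ρ.thr_ne_none_mono hij hj (by simp [hk])

theorem exists_inv (hi : i ≤ ρ.trace.length) (h : (ρ.conf i).thr t ≠ none) :
    ∃ j < i, ∃ m x, env t = some ⟨m, x⟩ ∧ ρ.trace[j]? = some (t, .inv m x) := by
  induction i with
  | zero => exact absurd (by rw [ρ.init]; rfl) h
  | succ i ih =>
    by_cases hn : (ρ.conf i).thr t = none
    · obtain ⟨u, ℓ, hℓ, htr⟩ := ρ.exists_trans hi
      obtain rfl : t = u := by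
        by_contra hu
        exact h (htr.thr_of_ne hu ▸ hn)
      obtain ⟨l, k, -, -, hinv⟩ := htr.thr_self
      obtain ⟨m, x, he, rfl⟩ := hinv hn
      exact ⟨i, i.lt_succ_self, m, x, he, hℓ⟩
    · obtain ⟨j, hj, hjt⟩ := ih (Nat.le_of_succ_le hi) hn
      exact ⟨j, hj.trans i.lt_succ_self, hjt⟩

theorem exists_ret {l : O.Lo} (hi : i ≤ ρ.trace.length)
    (h : (ρ.conf i).thr t = some (l, none)) : ∃ j < i, ∃ r, ρ.trace[j]? = some (t, .ret r) := by
  induction i with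
  | zero => cases (show none = some (l, none) from ρ.init ▸ h)
  | succ i ih =>
    obtain ⟨u, ℓ, hℓ, htr⟩ := ρ.exists_trans hi
    by_cases hu : t = u
    · subst hu
      obtain ⟨l', k, hk, hret, -⟩ := htr.thr_self
      obtain ⟨r, rfl⟩ := hret (congrArg Prod.snd (Option.some.inj (hk.symm.trans h)))
      exact ⟨i, i.lt_succ_self, r, hℓ⟩
    · obtain ⟨j, hj, hjt⟩ := ih (Nat.le_of_succ_le hi) (htr.thr_of_ne hu ▸ h)
      exact ⟨j, hj.trans i.lt_succ_self, hjt⟩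

end Execution

end Executions

/-! ### Rely-guarantee proof outlines -/

section ProofOutlines

variable {T : Type u} {O : ConcObject.{u, v, w} T} {Γ : Type*}

/-- A rely-guarantee discipline for the threads of an object, whose shared state is extended by an
auxiliary state in `Γ`. Every step of a thread `t` preserves `inv` and satisfies `guar t`, which
also sees the label of the step; `t` itself may rely on the steps of the others satisfying `rely t`.
Before the invocation of `t` the states satisfy `idle t`, afterwards its local state satisfies
`loc t`. -/
structure Protocol (O : ConcObject.{u, v, w} T) (Γ : Type*) where
  inv : O.Gl → Γ → Prop
  loc : T → O.Lo → Prop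
  rely : T → O.Gl → Γ → O.Gl → Γ → Prop
  guar : T → O.Lo → O.Gl → Γ → Label O → O.Gl → Γ → Prop
  idle : T → O.Gl → Γ → Prop
  loc_act : ∀ {t a l g l' g'}, loc t l → O.actSem a l g l' g' → loc t l'
  rely_of_guar : ∀ {t u l g γ ℓ g' γ'}, guar t l g γ ℓ g' γ' → u ≠ t → rely u g γ g' γ'
  idle_stable : ∀ {t g γ g' γ'}, idle t g γ → rely t g γ g' γ' → idle t g' γ'

namespace Protocol

/-- An assertion of the thread `t` that the steps of the other threads cannot invalidate. -/
structure Assertion (𝒢 : Protocol O Γ) (t : T) where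
  holds : O.Lo → O.Gl → Γ → Prop
  stable : ∀ {l g γ g' γ'}, holds l g γ → 𝒢.rely t g γ g' γ' → holds l g' γ'

namespace Assertion

variable {𝒢 : Protocol O Γ} {t : T}

instance : Min (𝒢.Assertion t) where
  min P Q := ⟨fun l g γ => P.holds l g γ ∧ Q.holds l g γ,
    fun h hr => ⟨P.stable h.1 hr, Q.stable h.2 hr⟩⟩

instance : Max (𝒢.Assertion t) where
  max P Q := ⟨fun l g γ => P.holds l g γ ∨ Q.holds l g γ,
    fun h hr => h.imp (P.stable · hr) (Q.stable · hr)⟩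

/-- The assertion that the local state satisfies `φ`. -/
def ofLocal (φ : O.Lo → Prop) : 𝒢.Assertion t where
  holds l _ _ := φ l
  stable h _ := h

end Assertion

variable (𝒢 : Protocol O Γ) (t : T)

/-- The Hoare triple with precondition `P` and postcondition `Q` of an atomic step of `t` with label
`ℓ` and meaning `exec`. The auxiliary state is updated by the proof. -/
def Atomic (P : 𝒢.Assertion t) (ℓ : Label O) (exec : O.Lo → O.Gl → O.Lo → O.Gl → Prop)
    (Q : 𝒢.Assertion t) : Prop :=
  ∀ l g γ l' g', 𝒢.inv g γ → 𝒢.loc t l → P.holds l g γ → exec l g l' g' →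
    ∃ γ', 𝒢.inv g' γ' ∧ 𝒢.guar t l g γ ℓ g' γ' ∧ Q.holds l' g' γ'

/-- Derivations of Hoare triples of `t`, built along the syntax of the code. Control never passes a
`ret`, so its postcondition is arbitrary. -/
inductive Outline : 𝒢.Assertion t → O.Code → 𝒢.Assertion t → Prop
  | act {P Q a} (h : 𝒢.Atomic t P (.act a) (O.actSem a) Q) : Outline P (.act a) Q
  | test {P Q b}
      (h : 𝒢.Atomic t P (.test b)
        (fun l g l' g' => (b.Holds fun c => O.testSem c l g) ∧ l' = l ∧ g' = g) Q) :
      Outline P (.test b) Q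
  | arw {P Q b a}
      (h : 𝒢.Atomic t P (.arw b a)
        (fun l g l' g' => (b.Holds fun c => O.testSem c l g) ∧ O.actSem a l g l' g') Q) :
      Outline P (.arw b a) Q
  | ret {P Q e}
      (h : ∀ l g γ, 𝒢.inv g γ → 𝒢.loc t l → P.holds l g γ →
        ∃ γ', 𝒢.inv g γ' ∧ 𝒢.guar t l g γ (.ret (O.retSem e l)) g γ') :
      Outline P (.ret e) Q
  | seq {P Q R k k'} (h : Outline P k Q) (h' : Outline Q k' R) : Outline P (.seq k k') R
  | plus {P Q k k'} (h : Outline P k Q) (h' : Outline P k' Q) : Outline P (.plus k k') Q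
  | star {P k} (h : Outline P k P) : Outline P (.star k) P
  | one {P} : Outline P .one P

/-- The rest of the code of `t`, if any, has a proof outline whose precondition holds. -/
def Runs (Q : 𝒢.Assertion t) (l : O.Lo) (g : O.Gl) (γ : Γ) : Option O.Code → Prop
  | none => True
  | some k => ∃ P : 𝒢.Assertion t, P.holds l g γ ∧ 𝒢.Outline t P k Q

variable {𝒢 t}

theorem Outline.silent_step {P Q : 𝒢.Assertion t} {k : O.Code} {l l' : O.Lo} {g g' : O.Gl} {γ : Γ}
    {k' : Option O.Code} (hk : 𝒢.Outline t P k Q) (hP : P.holds l g γ)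
    (h : Step O l g k none l' g' k') : l' = l ∧ g' = g ∧ 𝒢.Runs t Q l g γ k' := by
  generalize hℓ : (none : Option (Label O)) = ℓ at h
  induction h generalizing P Q with
  | act | test | arw | ret => cases hℓ
  | plusLeft => cases hk with | plus h _ => exact ⟨rfl, rfl, P, hP, h⟩
  | plusRight => cases hk with | plus _ h => exact ⟨rfl, rfl, P, hP, h⟩
  | starUnfold => cases hk with | star h => exact ⟨rfl, rfl, P, hP, h.seq h.star⟩
  | starExit => cases hk with | star => exact ⟨rfl, rfl, P, hP, .one⟩
  | seqOne => cases hk with | seq h h' => cases h with | one => exact ⟨rfl, rfl, P, hP, h'⟩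
  | seqStep _ ih =>
    cases hk with
    | seq h h' =>
      obtain ⟨rfl, rfl, P', hP', hk'⟩ := ih h hP hℓ
      exact ⟨rfl, rfl, P', hP', hk'.seq h'⟩
  | seqRet _ ih =>
    cases hk with
    | seq h _ =>
      obtain ⟨hl, hg, -⟩ := ih h hP hℓ
      exact ⟨hl, hg, trivial⟩

theorem Outline.labelled_step {P Q : 𝒢.Assertion t} {k : O.Code} {l l' : O.Lo} {g g' : O.Gl} {γ : Γ}
    {ℓ : Label O} {k' : Option O.Code} (hk : 𝒢.Outline t P k Q) (hP : P.holds l g γ)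
    (hg : 𝒢.inv g γ) (hl : 𝒢.loc t l) (h : Step O l g k (some ℓ) l' g' k') :
    𝒢.loc t l' ∧ ∃ γ', 𝒢.inv g' γ' ∧ 𝒢.guar t l g γ ℓ g' γ' ∧ 𝒢.Runs t Q l' g' γ' k' := by
  generalize hℓ : some ℓ = ℓ' at h
  induction h generalizing P Q with
  | act ha =>
    cases hℓ
    cases hk with
    | act h =>
      obtain ⟨γ', hg', hguar, hQ⟩ := h _ _ _ _ _ hg hl hP ha
      exact ⟨𝒢.loc_act hl ha, γ', hg', hguar, Q, hQ, .one⟩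
  | test hb =>
    cases hℓ
    cases hk with
    | test h =>
      obtain ⟨γ', hg', hguar, hQ⟩ := h _ _ _ _ _ hg hl hP ⟨hb, rfl, rfl⟩
      exact ⟨hl, γ', hg', hguar, Q, hQ, .one⟩
  | arw hb ha =>
    cases hℓ
    cases hk with
    | arw h =>
      obtain ⟨γ', hg', hguar, hQ⟩ := h _ _ _ _ _ hg hl hP ⟨hb, ha⟩
      exact ⟨𝒢.loc_act hl ha, γ', hg', hguar, Q, hQ, .one⟩
  | ret =>
    cases hℓ
    cases hk with
    | ret h =>
      obtain ⟨γ', hg', hguar⟩ := h _ _ _ hg hl hP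
      exact ⟨hl, γ', hg', hguar, trivial⟩
  | plusLeft | plusRight | starUnfold | starExit | seqOne => cases hℓ
  | seqStep _ ih =>
    cases hk with
    | seq h h' =>
      obtain ⟨hl', γ', hg', hguar, P', hP', hk'⟩ := ih h hP hℓ
      exact ⟨hl', γ', hg', hguar, P', hP', hk'.seq h'⟩
  | seqRet _ ih =>
    cases hk with
    | seq h _ =>
      obtain ⟨hl', γ', hg', hguar, -⟩ := ih h hP hℓ
      exact ⟨hl', γ', hg', hguar, trivial⟩

theorem Outline.bigStep {P Q : 𝒢.Assertion t} {k : O.Code} {l l' : O.Lo} {g g' : O.Gl} {γ : Γ}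
    {ℓ : Label O} {k' : Option O.Code} (hk : 𝒢.Outline t P k Q) (hP : P.holds l g γ)
    (hg : 𝒢.inv g γ) (hl : 𝒢.loc t l) (h : BigStep O l g k ℓ l' g' k') :
    𝒢.loc t l' ∧ ∃ γ', 𝒢.inv g' γ' ∧ 𝒢.guar t l g γ ℓ g' γ' ∧ 𝒢.Runs t Q l' g' γ' k' := by
  induction h generalizing P with
  | last h => exact hk.labelled_step hP hg hl h
  | silent h _ ih =>
    obtain ⟨rfl, rfl, _, hP', hk'⟩ := hk.silent_step hP h
    exact ih hk' hP' hg hl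

variable (𝒢) in
/-- Every prescribed invocation establishes the precondition of a proof outline of its method. -/
def Verifies (env : Env O) : Prop :=
  ∀ t m x, env t = some ⟨m, x⟩ → 𝒢.loc t (O.initLo t m x) ∧
    ∃ P Q : 𝒢.Assertion t, (∀ g γ, 𝒢.idle t g γ → P.holds (O.initLo t m x) g γ) ∧
      𝒢.Outline t P (O.code m) Q

variable (𝒢) in
/-- The part of the invariant of a configuration that concerns the thread `t`. -/
def ThreadInv (t : T) (g : O.Gl) (γ : Γ) : Option (O.Lo × Option O.Code) → Prop
  | none => 𝒢.idle t g γ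
  | some (l, k) => 𝒢.loc t l ∧ ∃ Q, 𝒢.Runs t Q l g γ k

theorem ThreadInv.stable {g g' : O.Gl} {γ γ' : Γ} {s : Option (O.Lo × Option O.Code)}
    (h : 𝒢.ThreadInv t g γ s) (hr : 𝒢.rely t g γ g' γ') : 𝒢.ThreadInv t g' γ' s := by
  rcases s with _ | ⟨l, _ | k⟩
  · exact 𝒢.idle_stable h hr
  · exact h
  · obtain ⟨hl, Q, P, hP, hk⟩ := h
    exact ⟨hl, Q, P, P.stable hP hr, hk⟩

variable (𝒢) in
/-- The invariant of a configuration. -/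
structure Holds (C : Config O) (γ : Γ) : Prop where
  inv : 𝒢.inv C.gl γ
  thr : ∀ t, 𝒢.ThreadInv t C.gl γ (C.thr t)

variable (𝒢) in
/-- The effect of a transition with label `(t, ℓ)` on the auxiliary state: invocations leave it
unchanged, all other steps satisfy the guarantee. -/
def Allows (C : Config O) (γ : Γ) (t : T) (ℓ : Label O) (C' : Config O) (γ' : Γ) : Prop :=
  (∃ m x, ℓ = .inv m x ∧ γ' = γ) ∨
    ∃ l k, C.thr t = some (l, k) ∧ 𝒢.guar t l C.gl γ ℓ C'.gl γ'

variable [DecidableEq T] {env : Env O}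

theorem Holds.trans {C C' : Config O} {γ : Γ} {ℓ : Label O} (h : 𝒢.Holds C γ)
    (hv : 𝒢.Verifies env) (htr : Trans O env C (t, ℓ) C') :
    ∃ γ', 𝒢.Holds C' γ' ∧ 𝒢.Allows C γ t ℓ C' γ' := by
  have htht := h.thr t
  cases htr with
  | inv he ht =>
    rw [ht] at htht
    obtain ⟨hl, P, Q, hP, hk⟩ := hv _ _ _ he
    refine ⟨γ, ⟨h.inv, ?_⟩, .inl ⟨_, _, rfl, rfl⟩⟩
    exact (Function.forall_update_iff _ fun u s => 𝒢.ThreadInv u C.gl γ s).2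
      ⟨⟨hl, Q, P, hP _ _ htht, hk⟩, fun u _ => h.thr u⟩
  | step ht hb =>
    rw [ht] at htht
    obtain ⟨hl, Q, P, hP, hk⟩ := htht
    obtain ⟨hl', γ', hg', hguar, hruns⟩ := hk.bigStep hP h.inv hl hb
    refine ⟨γ', ⟨hg', ?_⟩, .inr ⟨_, _, ht, hguar⟩⟩
    exact (Function.forall_update_iff _ fun u s => 𝒢.ThreadInv u _ γ' s).2
      ⟨⟨hl', Q, hruns⟩, fun u hu => (h.thr u).stable (𝒢.rely_of_guar hguar hu)⟩

theorem exists_auxiliary_states (hv : 𝒢.Verifies env) (ρ : Execution O env) {γ₀ : Γ}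
    (h₀ : 𝒢.Holds (Config.init O) γ₀) :
    ∃ γ : ℕ → Γ, γ 0 = γ₀ ∧ (∀ i ≤ ρ.trace.length, 𝒢.Holds (ρ.conf i) (γ i)) ∧
      ∀ i t ℓ, ρ.trace[i]? = some (t, ℓ) →
        𝒢.Allows (ρ.conf i) (γ i) t ℓ (ρ.conf (i + 1)) (γ (i + 1)) := by
  have hstep : ∀ i γ, ∃ γ', i < ρ.trace.length → 𝒢.Holds (ρ.conf i) γ →
      𝒢.Holds (ρ.conf (i + 1)) γ' ∧ ∀ t ℓ, ρ.trace[i]? = some (t, ℓ) →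
        𝒢.Allows (ρ.conf i) γ t ℓ (ρ.conf (i + 1)) γ' := by
    intro i γ
    by_cases h : i < ρ.trace.length ∧ 𝒢.Holds (ρ.conf i) γ
    · obtain ⟨t, ℓ, hℓ, htr⟩ := ρ.exists_trans h.1
      obtain ⟨γ', hγ', ha⟩ := h.2.trans hv htr
      refine ⟨γ', fun _ _ => ⟨hγ', fun t' ℓ' hℓ' => ?_⟩⟩
      cases hℓ.symm.trans hℓ'
      exact ha
    · exact ⟨γ, fun hi hγ => absurd ⟨hi, hγ⟩ h⟩
  choose next hnext using hstep
  let γ : ℕ → Γ := fun i => Nat.rec γ₀ next i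
  have hγ : ∀ i ≤ ρ.trace.length, 𝒢.Holds (ρ.conf i) (γ i) := by
    intro i hi
    induction i with
    | zero => exact ρ.init ▸ h₀
    | succ i ih => exact (hnext i (γ i) hi (ih (Nat.le_of_succ_le hi))).1
  refine ⟨γ, rfl, hγ, fun i t ℓ hℓ => ?_⟩
  have hi := (List.getElem?_eq_some_iff.1 hℓ).1
  exact (hnext i (γ i) hi (hγ i hi.le)).2 t ℓ hℓ

end Protocol

end ProofOutlines

/-! ### Linearization in batches -/

section Batches

variable {T : Type u}

/-- The linearization order up to the position `n` in which the step at each position `i < n`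
linearizes the threads in `batch i`. -/
def linOrder (batch : ℕ → List T) (n : ℕ) : List T := (List.range n).flatMap batch

/-- The position whose batch contains `t`; it is `0` if there is none. -/
noncomputable def linPoint (batch : ℕ → List T) (t : T) : ℕ := sInf {i | t ∈ batch i}

variable {batch : ℕ → List T} {i k n : ℕ} {t : T}

theorem mem_linOrder : t ∈ linOrder batch n ↔ ∃ i < n, t ∈ batch i := by
  simp only [linOrder, List.mem_flatMap, List.mem_range]

theorem linOrder_succ : linOrder batch (n + 1) = linOrder batch n ++ batch n := by
  simp only [linOrder, List.range_succ, List.flatMap_append, List.flatMap_singleton]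

theorem exists_linOrder_eq_append (h : k < n) :
    ∃ ts, linOrder batch n = linOrder batch k ++ (batch k ++ ts) := by
  induction n, h using Nat.le_induction with
  | base => exact ⟨[], by rw [linOrder_succ, List.append_nil]⟩
  | succ n _ ih =>
    obtain ⟨ts, hts⟩ := ih
    exact ⟨ts ++ batch n, by simp only [linOrder_succ, hts, List.append_assoc]⟩

theorem linPoint_eq (h : (linOrder batch n).Nodup) (hi : i < n) (ht : t ∈ batch i) :
    linPoint batch t = i := by
  refine (Nat.sInf_le ht).antisymm (not_lt.1 fun hlt => ?_)
  obtain ⟨ts, hts⟩ := exists_linOrder_eq_append (batch := batch) hi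
  have hmem : t ∈ batch (linPoint batch t) := Nat.sInf_mem (s := {i | t ∈ batch i}) ⟨i, ht⟩
  exact List.disjoint_of_nodup_append (hts ▸ h) (mem_linOrder.2 ⟨_, hlt, hmem⟩)
    (List.mem_append_left _ ht)

theorem linOrder_sorted (h : (linOrder batch n).Nodup) :
    (linOrder batch n).Pairwise fun s t => linPoint batch s ≤ linPoint batch t := by
  refine List.pairwise_flatMap.2 ⟨fun i hi => ?_, List.pairwise_lt_range.imp_of_mem ?_⟩
  · refine List.pairwise_of_forall_mem_list fun s hs t ht => ?_
    rw [linPoint_eq h (List.mem_range.1 hi) hs, linPoint_eq h (List.mem_range.1 hi) ht]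
  · intro i j hi hj hij s hs t ht
    rw [linPoint_eq h (List.mem_range.1 hi) hs, linPoint_eq h (List.mem_range.1 hj) ht]
    exact hij.le

variable [DecidableEq T] {O : ConcObject.{u, v, w} T} {env : Env O} {ρ : Execution O env}
  {res : T → Option O.Ret}

/-- Each step of `ρ` linearizes the threads in its batch between their invocations and returns, and
binds them to return the values in `res`. -/
structure IsSchedule (ρ : Execution O env) (batch : ℕ → List T) (res : T → Option O.Ret) :
    Prop where
  nodup : (linOrder batch ρ.trace.length).Nodup
  invoked : ∀ i < ρ.trace.length, ∀ t ∈ batch i, (ρ.conf i).thr t ≠ none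
  returned : ∀ j t r, ρ.trace[j]? = some (t, .ret r) → res t = some r ∧ ∃ i < j, t ∈ batch i

namespace IsSchedule

theorem linPoint_eq (h : IsSchedule ρ batch res) (hi : i < ρ.trace.length) (ht : t ∈ batch i) :
    linPoint batch t = i :=
  KatObj.linPoint_eq h.nodup hi ht

theorem exists_ret (h : IsSchedule ρ batch res) (hρ : ρ.Completed) (hi : i ≤ ρ.trace.length)
    (ht : (ρ.conf i).thr t ≠ none) :
    ∃ j r, ρ.trace[j]? = some (t, .ret r) ∧ res t = some r ∧ t ∈ linOrder batch ρ.trace.length ∧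
      linPoint batch t < j := by
  obtain ⟨⟨l, k⟩, hk⟩ := Option.ne_none_iff_exists'.1 (ρ.thr_ne_none_mono hi le_rfl ht)
  obtain rfl := hρ _ _ _ hk
  obtain ⟨j, hj, r, hr⟩ := ρ.exists_ret le_rfl hk
  obtain ⟨hres, i', hi', ht'⟩ := h.returned _ _ _ hr
  refine ⟨j, r, hr, hres, mem_linOrder.2 ⟨i', hi'.trans hj, ht'⟩, ?_⟩
  rwa [h.linPoint_eq (hi'.trans hj) ht']

theorem operationOf (h : IsSchedule ρ batch res) (hρ : ρ.Completed)
    (ht : t ∈ linOrder batch ρ.trace.length) {o : OpSym O.Meth O.Arg O.Ret}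
    (he : env t = some ⟨o.meth, o.arg⟩) (hr : res t = some o.ret) : OperationOf ρ.trace t o := by
  obtain ⟨i, hi, hti⟩ := mem_linOrder.1 ht
  obtain ⟨j, -, m, x, he', hinv⟩ := ρ.exists_inv hi.le (h.invoked i hi t hti)
  obtain ⟨j', r, hret, hr', -⟩ := h.exists_ret hρ hi.le (h.invoked i hi t hti)
  cases he.symm.trans he'
  cases hr.symm.trans hr'
  exact ⟨List.mem_of_getElem? hinv, List.mem_of_getElem? hret⟩

theorem isLinearization (h : IsSchedule ρ batch res) (hρ : ρ.Completed)
    {S : Set (List (OpSym O.Meth O.Arg O.Ret))} {os : List (OpSym O.Meth O.Arg O.Ret)}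
    (hos : os ∈ S)
    (hspec : List.Forall₂ (fun t o => env t = some ⟨o.meth, o.arg⟩ ∧ res t = some o.ret)
      (linOrder batch ρ.trace.length) os) :
    IsLinearization S ρ.trace (linPoint batch) (linOrder batch ρ.trace.length) where
  nodup := h.nodup
  mem_iff t := by
    constructor
    · intro ht
      obtain ⟨i, hi, hti⟩ := mem_linOrder.1 ht
      obtain ⟨j, -, m, x, -, hinv⟩ := ρ.exists_inv hi.le (h.invoked i hi t hti)
      exact ⟨m, x, List.mem_of_getElem? hinv⟩
    · rintro ⟨m, x, hinv⟩
      obtain ⟨i, hi⟩ := List.getElem?_of_mem hinv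
      have hlt := (List.getElem?_eq_some_iff.1 hi).1
      obtain ⟨-, -, -, -, ht, -⟩ :=
        h.exists_ret hρ le_rfl (ρ.thr_ne_none_of_getElem? hi hlt le_rfl)
      exact ht
  sorted := linOrder_sorted h.nodup
  between t ht := by
    obtain ⟨i, hi, hti⟩ := mem_linOrder.1 ht
    obtain ⟨j, hj, m, x, -, hinv⟩ := ρ.exists_inv hi.le (h.invoked i hi t hti)
    obtain ⟨j', r, hret, -, -, hj'⟩ := h.exists_ret hρ hi.le (h.invoked i hi t hti)
    exact ⟨j, j', m, x, r, (h.linPoint_eq hi hti).symm ▸ hj, hj', hinv, hret⟩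
  spec := by
    obtain ⟨hlen, hspec⟩ := List.forall₂_iff_zip.1 hspec
    exact ⟨os, hos, List.forall₂_iff_zip.2 ⟨hlen, fun hmem =>
      h.operationOf hρ (List.of_mem_zip hmem).1 (hspec hmem).1 (hspec hmem).2⟩⟩

end IsSchedule

end Batches

/-! ### The sequential stack -/

section SequentialStack

variable {Val : Type v} {empty : Val} {s s' s'' : List Val} {os os' : List (StackOp Val)} {x : Val}

/-- Executing `os` from the stack `s` leaves the stack `s'`. Since `StackRun` does not expose the
final stack, this is expressed through the operations that can follow. -/
def LeadsTo (empty : Val) (s : List Val) (os : List (StackOp Val)) (s' : List Val) : Prop :=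
  ∀ os', StackRun empty s' os' → StackRun empty s (os ++ os')

theorem LeadsTo.trans (h : LeadsTo empty s os s') (h' : LeadsTo empty s' os' s'') :
    LeadsTo empty s (os ++ os') s'' :=
  fun _ hos => List.append_assoc .. ▸ h _ (h' _ hos)

theorem leadsTo_push : LeadsTo empty s [⟨.push, x, none⟩] (x :: s) :=
  fun _ h => ⟨rfl, h⟩

theorem leadsTo_pop : LeadsTo empty (x :: s) [⟨.pop, PUnit.unit, some x⟩] s :=
  fun _ h => ⟨rfl, h⟩

theorem leadsTo_pop_nil : LeadsTo empty [] [⟨.pop, PUnit.unit, some empty⟩] [] :=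
  fun _ h => ⟨rfl, h⟩

end SequentialStack

/-! ### Invariant and rely condition of the elimination stack -/

section Histories

/-- The threads linearized so far, in linearization order, and the values they are bound to
return. -/
structure History (T : Type u) (Val : Type v) where
  ts : List T
  res : T → Option (Option Val)

variable {T : Type u} {Val : Type v} [DecidableEq T] {empty : Val}

/-- Linearize `t`, which is bound to return `r`. -/
def History.lin (H : History T Val) (t : T) (r : Option Val) : History T Val :=
  ⟨H.ts ++ [t], Function.update H.res t (some r)⟩

variable {env : Env (elimStack T empty)} {H : History T Val} {s s' : List Val} {t : T}

variable (env) in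
/-- The operations of the linearized threads are a sequential execution that leaves the stack
`s`. -/
structure History.Leaves (H : History T Val) (s : List Val) : Prop where
  nodup : H.ts.Nodup
  mem_iff : ∀ t, t ∈ H.ts ↔ H.res t ≠ none
  spec : ∃ os : List (StackOp Val),
    List.Forall₂ (fun t o => env t = some ⟨o.meth, o.arg⟩ ∧ H.res t = some o.ret) H.ts os ∧
      LeadsTo empty [] os s

theorem History.leaves_nil : History.Leaves env ⟨[], fun _ => none⟩ [] where
  nodup := .nil
  mem_iff t := by simp only [List.not_mem_nil, ne_eq, not_true_eq_false]
  spec := ⟨[], .nil, fun _ h => h⟩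

theorem History.Leaves.lin {m : StackMeth} {x : StackArg Val m} {r : Option Val}
    (h : H.Leaves env s) (ht : H.res t = none) (he : env t = some ⟨m, x⟩)
    (hs : LeadsTo empty s [⟨m, x, r⟩] s') : (H.lin t r).Leaves env s' := by
  have hmem : t ∉ H.ts := fun hmem => (h.mem_iff t).1 hmem ht
  refine ⟨h.nodup.append (List.nodup_singleton t) (List.disjoint_singleton.2 hmem), fun u => ?_, ?_⟩
  · by_cases hu : u = t
    · simp [History.lin, hu]
    · simp [History.lin, hu, h.mem_iff]
  · obtain ⟨os, hos, hleads⟩ := h.spec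
    refine ⟨os ++ [⟨m, x, r⟩], List.rel_append ?_ (.cons ⟨he, ?_⟩ .nil), hleads.trans hs⟩
    · obtain ⟨hlen, hos⟩ := List.forall₂_iff_zip.1 hos
      refine List.forall₂_iff_zip.2 ⟨hlen, fun {u o} hmem' => ⟨(hos hmem').1, ?_⟩⟩
      have hu : u ≠ t := fun hu => hmem (hu ▸ (List.of_mem_zip hmem').1)
      exact (Function.update_of_ne hu ..).trans (hos hmem').2
    · exact Function.update_self ..

/-- The environment lets `t` push `x`. -/
def Pushes (env : Env (elimStack T empty)) (t : T) (x : Val) : Prop :=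
  env t = some ⟨StackMeth.push, x⟩

/-- The environment lets `t` pop. -/
def Pops (env : Env (elimStack T empty)) (t : T) : Prop :=
  env t = some ⟨StackMeth.pop, PUnit.unit⟩

theorem History.Leaves.push {x : Val} (h : H.Leaves env s) (ht : H.res t = none)
    (he : Pushes env t x) : (H.lin t none).Leaves env (x :: s) :=
  h.lin ht he leadsTo_push

theorem History.Leaves.pop {x : Val} (h : H.Leaves env (x :: s)) (ht : H.res t = none)
    (he : Pops env t) : (H.lin t (some x)).Leaves env s :=
  h.lin ht he leadsTo_pop

theorem History.Leaves.pop_nil (h : H.Leaves env []) (ht : H.res t = none) (he : Pops env t) :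
    (H.lin t (some empty)).Leaves env [] :=
  h.lin ht he leadsTo_pop_nil

theorem History.Leaves.push_pop {t' : T} {x : Val} (h : H.Leaves env s) (ht : H.res t = none)
    (ht' : H.res t' = none) (hne : t' ≠ t) (he : Pushes env t x) (he' : Pops env t') :
    ((H.lin t none).lin t' (some x)).Leaves env s :=
  (h.push ht he).pop ((Function.update_of_ne hne ..).trans ht') he'

end Histories

section Invariant

/-- The auxiliary state: the history and the owners of the nodes. A node is owned by the thread that
allocated it until its address is written to `top`; it is public afterwards, which is encoded by
`none`, and is not modified any more. -/
structure Ghost (T : Type u) (Val : Type v) extends History T Val where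
  owner : ℕ → Option T

variable {T : Type u} {Val : Type v} {g g' : Shared T Val} {γ γ' : Ghost T Val} {t : T}

/-- The address `a` holds the node `d`, which belongs to `o`. -/
def Owns (g : Shared T Val) (γ : Ghost T Val) (o : Option T) (a : ℕ) (d : Node Val) : Prop :=
  γ.owner a = o ∧ g.heap a = some d

/-- The public linked list starting at a pointer holds the values of the stack, top first. -/
inductive Chain (g : Shared T Val) (γ : Ghost T Val) : Option ℕ → List Val → Prop
  | nil : Chain g γ none []
  | cons {a x ptr s} (ha : Owns g γ none a ⟨some x, ptr⟩) (h : Chain g γ ptr s) :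
      Chain g γ (some a) (x :: s)

theorem Chain.mono {ptr : Option ℕ} {s : List Val} (h : Chain g γ ptr s)
    (hown : ∀ a d, Owns g γ none a d → Owns g' γ' none a d) : Chain g' γ' ptr s := by
  induction h with
  | nil => exact .nil
  | cons ha _ ih => exact .cons (hown _ _ ha) ih

/-- The value that the passive party of a collision, which executes `m`, finds in its `location`
cell. -/
def received (m : StackMeth) (cell : Option (Desc T Val)) : Option Val :=
  match m with
  | .push => none
  | .pop => cell.bind Desc.input

theorem pushPop_bind_input (l : Locals T Val) (cell : Option (Desc T Val)) :
    l.pushPop none (cell.bind Desc.input) = received l.p.op cell := by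
  unfold Locals.pushPop received
  cases l.p.op <;> rfl

/-- The thread `t`, which executes `m`, has been linearized by the active party of a collision. -/
def Collided (t : T) (m : StackMeth) (g : Shared T Val) (γ : Ghost T Val) : Prop :=
  γ.res t = some (received m (g.location t)) ∧ ∀ d, g.location t = some d → d.id ≠ t

/-- What the other threads do from the point of view of `t`: they modify neither the public nodes
nor those owned by `t`, and they linearize `t` only in a collision, when `t` is waiting. -/
structure Rely (t : T) (g : Shared T Val) (γ : Ghost T Val) (g' : Shared T Val)
    (γ' : Ghost T Val) : Prop where
  owns : ∀ o a d, o = none ∨ o = some t → Owns g γ o a d → Owns g' γ' o a d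
  slot : γ'.res t = γ.res t ∧ g'.location t = g.location t ∨
    ∃ d, g.location t = some d ∧ d.id = t ∧ Collided t d.op g' γ'

/-- `t` does not modify the nodes of the other threads, nor the public ones. -/
def Spares (t : T) (g : Shared T Val) (γ : Ghost T Val) (g' : Shared T Val) (γ' : Ghost T Val) :
    Prop :=
  ∀ o a d, o ≠ some t → Owns g γ o a d → Owns g' γ' o a d

theorem Spares.rely {u : T} (h : Spares t g γ g' γ') (hu : u ≠ t)
    (hslot : γ'.res u = γ.res u ∧ g'.location u = g.location u ∨
      ∃ d, g.location u = some d ∧ d.id = u ∧ Collided u d.op g' γ') : Rely u g γ g' γ' where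
  owns o a d ho := h o a d (by rcases ho with rfl | rfl <;> simp [hu])
  slot := hslot

variable [DecidableEq T] {empty : Val} {env : Env (elimStack T empty)}

variable (env) in
/-- The descriptor of the invocation of `t`. -/
def descOf (t : T) : Option (Desc T Val) :=
  (env t).map fun ⟨m, x⟩ => ((elimStack T empty).initLo t m x).p

theorem descOf_of_pushes {x : Val} (h : Pushes env t x) :
    descOf env t = some ⟨.push, t, some x⟩ := by
  rw [descOf, h]
  rfl

theorem descOf_eq_some {d : Desc T Val} (h : descOf env t = some d) :
    (∃ x, Pushes env t x ∧ d = ⟨.push, t, some x⟩) ∨ Pops env t ∧ d = ⟨.pop, t, none⟩ := by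
  rcases he : env t with _ | ⟨_ | _, x⟩ <;> rw [descOf, he] at h <;> cases h
  · exact .inl ⟨x, he, rfl⟩
  · exact .inr ⟨he, rfl⟩

theorem id_of_descOf {d : Desc T Val} (h : descOf env t = some d) : d.id = t := by
  obtain ⟨_, -, rfl⟩ | ⟨-, rfl⟩ := descOf_eq_some h <;> rfl

variable (env) in
/-- A thread that finds its own descriptor in its `location` cell has not been linearized. -/
def Waiting (g : Shared T Val) (γ : Ghost T Val) (t : T) : Prop :=
  ∀ d, g.location t = some d → d.id = t → descOf env t = some d ∧ γ.res t = none

theorem Waiting.congr (h : Waiting env g γ t) (hloc : g'.location t = g.location t)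
    (hres : γ'.res t = γ.res t) : Waiting env g' γ' t := by
  simpa only [Waiting, hloc, hres] using h

theorem waiting_of_location (h : ∀ d, g.location t = some d → d.id ≠ t) : Waiting env g γ t :=
  fun d hd hid => absurd hid (h d hd)

variable (env) in
/-- The invariant of the shared state. -/
structure SharedInv (g : Shared T Val) (γ : Ghost T Val) : Prop where
  waiting : ∀ t, Waiting env g γ t
  stack : ∃ s, γ.Leaves env s ∧ Chain g γ g.top s

/-- The labels of the CASs that linearize threads. -/
def IsLinCAS : Label (elimStack T empty) → Prop
  | .arw (.prim .topEqOld) .topToN => True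
  | .arw (.prim .topEqOld) .topToNew => True
  | .arw (.prim .himEqQ) .setHim => True
  | _ => False

variable (env) in
/-- A step of `t` from the states `l` and `g` with the label `ℓ` linearizes the threads in `new` and
so extends `H` to `H'`. -/
inductive Linearizes (t : T) (l : Locals T Val) (g : Shared T Val) (H : History T Val) :
    (ℓ : Label (elimStack T empty)) → (new : List T) → (H' : History T Val) → Prop
  | silent {ℓ} (hℓ : ¬ IsLinCAS ℓ) (hret : ∀ r, ℓ = .ret r → H.res t = some r) :
      Linearizes t l g H ℓ [] H
  | topCAS {a r} (ha : a = .topToN ∨ a = .topToNew) :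
      Linearizes t l g H (.arw (.prim .topEqOld) a) [t] (H.lin t r)
  | emptyRead (ht : Pops env t) (htop : g.top = none) :
      Linearizes t l g H (.act .readTop) [t] (H.lin t (some empty))
  | collision {b s₁ s₂ x} (hb : l.him = some b) (hloc : g.location b ≠ none)
      (hs : s₁ = t ∧ s₂ = b ∨ s₁ = b ∧ s₂ = t) (h₁ : Pushes env s₁ x) (h₂ : Pops env s₂) :
      Linearizes t l g H (.arw (.prim .himEqQ) .setHim) [s₁, s₂]
        ((H.lin s₁ none).lin s₂ (some x))

theorem loc_of_sActSem {a : SAct} {l l' : Locals T Val} (h : sActSem a l g l' g') :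
    l'.mytid = l.mytid ∧ l'.p = l.p := by
  cases a <;> simp only [sActSem] at h <;> grind

variable (env) in
/-- The rely-guarantee discipline of the elimination stack. -/
def elimProtocol : Protocol (elimStack T empty) (Ghost T Val) where
  inv := SharedInv env
  loc t (l : Locals T Val) := l.mytid = t ∧ descOf env t = some l.p
  rely := Rely
  guar t l g γ ℓ g' γ' :=
    (∃ new, Linearizes env t l g γ.toHistory ℓ new γ'.toHistory) ∧ ∀ u ≠ t, Rely u g γ g' γ'
  idle t (g : Shared T Val) γ := γ.res t = none ∧ g.location t = none
  loc_act {t a l g l' g'} h ha := by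
    obtain ⟨hid, hp⟩ := loc_of_sActSem ha
    exact ⟨hid.trans h.1, hp ▸ h.2⟩
  rely_of_guar h hu := h.2 _ hu
  idle_stable := by
    rintro t g γ g' γ' ⟨hres, hloc⟩ h
    rcases h.slot with ⟨hres', hloc'⟩ | ⟨d, hd, -⟩
    · exact ⟨hres'.trans hres, hloc'.trans hloc⟩
    · cases hloc.symm.trans hd

end Invariant

/-! ### Proof outlines of the methods -/

section Rules

variable {T : Type u} {Val : Type v} [DecidableEq T] {empty : Val} {env : Env (elimStack T empty)}
  {t : T} {g g' : Shared T Val} {γ γ' : Ghost T Val} {P Q : (elimProtocol env).Assertion t}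

variable (env) in
/-- The effect of a step of `t` that linearizes no thread. -/
structure Frame (t : T) (g : Shared T Val) (γ : Ghost T Val) (g' : Shared T Val)
    (γ' : Ghost T Val) : Prop where
  top : g'.top = g.top
  history : γ'.toHistory = γ.toHistory
  location : ∀ u ≠ t, g'.location u = g.location u
  waiting : Waiting env g' γ' t
  spares : Spares t g γ g' γ'

namespace Frame

theorem res (h : Frame env t g γ g' γ') (u : T) : γ'.res u = γ.res u :=
  congrArg (History.res · u) h.history

theorem sharedInv (h : Frame env t g γ g' γ') (hg : SharedInv env g γ) : SharedInv env g' γ' where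
  waiting u := by
    by_cases hu : u = t
    · exact hu ▸ h.waiting
    · exact (hg.waiting u).congr (h.location u hu) (h.res u)
  stack := by
    obtain ⟨s, hs, hchain⟩ := hg.stack
    exact ⟨s, h.history ▸ hs, h.top ▸ hchain.mono fun a d => h.spares none a d nofun⟩

theorem rely {u : T} (h : Frame env t g γ g' γ') (hu : u ≠ t) : Rely u g γ g' γ' :=
  h.spares.rely hu (.inl ⟨h.res u, h.location u hu⟩)

theorem refl (hg : SharedInv env g γ) : Frame env t g γ g γ where
  top := rfl
  history := rfl
  location _ _ := rfl
  waiting := hg.waiting t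
  spares _ _ _ _ h := h

theorem guar (h : Frame env t g γ g' γ') {l : Locals T Val} {ℓ : Label (elimStack T empty)}
    (hℓ : ¬ IsLinCAS ℓ) (hret : ∀ r, ℓ = .ret r → γ.res t = some r) :
    (elimProtocol env).guar t l g γ ℓ g' γ' :=
  ⟨⟨[], by rw [h.history]; exact .silent hℓ hret⟩, fun _ hu => h.rely hu⟩

theorem clear :
    Frame env t g γ { g with location := Function.update g.location t none } γ where
  top := rfl
  history := rfl
  location _ hu := Function.update_of_ne hu ..
  waiting := waiting_of_location (by simp)
  spares _ _ _ _ h := h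

end Frame

theorem atomic_of_frame {ℓ : Label (elimStack T empty)}
    {exec : Locals T Val → Shared T Val → Locals T Val → Shared T Val → Prop}
    (hℓ : ¬ IsLinCAS ℓ) (hret : ∀ r, ℓ ≠ .ret r)
    (h : ∀ l g γ l' g', SharedInv env g γ → (elimProtocol env).loc t l → P.holds l g γ →
      exec l g l' g' → ∃ γ', Frame env t g γ g' γ' ∧ Q.holds l' g' γ') :
    (elimProtocol env).Atomic t P ℓ exec Q := by
  intro l g γ l' g' hg hl hP he
  obtain ⟨γ', hframe, hQ⟩ := h l g γ l' g' hg hl hP he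
  exact ⟨γ', hframe.sharedInv hg, hframe.guar hℓ fun r hr => absurd hr (hret r), hQ⟩

theorem outline_act {a : SAct}
    (h : ∀ l g γ l' g', SharedInv env g γ → (elimProtocol env).loc t l → P.holds l g γ →
      sActSem a l g l' g' → ∃ γ', Frame env t g γ g' γ' ∧ Q.holds l' g' γ') :
    (elimProtocol env).Outline t P (.act a) Q :=
  .act (atomic_of_frame id nofun h)

theorem outline_test {b : BExp STest}
    (h : ∀ (l : Locals T Val) g γ, (elimProtocol env).loc t l → P.holds l g γ →
      b.Holds (sTestSem · l g) → Q.holds l g γ) :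
    (elimProtocol env).Outline t P (.test b) Q :=
  .test <| atomic_of_frame id nofun <| by
    rintro l g γ _ _ hg hl hP ⟨hb, rfl, rfl⟩
    exact ⟨γ, .refl hg, h _ _ _ hl hP hb⟩

theorem outline_ret {e : SRet}
    (h : ∀ l g γ, (elimProtocol env).loc t l → P.holds l g γ →
      γ.res t = some (sRetSem empty e l)) :
    (elimProtocol env).Outline t P (.ret e) Q :=
  .ret fun l g γ hg hl hP =>
    ⟨γ, hg, (Frame.refl hg).guar id fun _ hr => Label.ret.inj hr ▸ h l g γ hl hP⟩

end Rules

section Assertions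

open Protocol Assertion

variable {T : Type u} {Val : Type v} [DecidableEq T] {empty : Val} (env : Env (elimStack T empty))
  (t : T)

/-- `t` has not been linearized and offers no collision. -/
def unlinearized : (elimProtocol env).Assertion t where
  holds _ (g : Shared T Val) γ := γ.res t = none ∧ g.location t = none
  stable := (elimProtocol env).idle_stable

/-- `t` has been linearized and is bound to return the value `r` of its local state. -/
def committed (r : Locals T Val → Option Val) : (elimProtocol env).Assertion t where
  holds l (g : Shared T Val) γ := g.location t = none ∧ γ.res t = some (r l)
  stable := by
    rintro l g γ g' γ' ⟨hloc, hres⟩ h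
    rcases h.slot with ⟨hres', hloc'⟩ | ⟨d, hd, -⟩
    · exact ⟨hloc'.trans hloc, hres'.trans hres⟩
    · cases hloc.symm.trans hd

/-- A local pointer points to a node with property `φ` that is public or owned by `t`. -/
def pointsTo (o : Option T) (ho : o = none ∨ o = some t) (ptr : Locals T Val → Option ℕ)
    (φ : Locals T Val → Node Val → Prop) : (elimProtocol env).Assertion t where
  holds l g γ := ∃ a d, ptr l = some a ∧ Owns g γ o a d ∧ φ l d
  stable := by
    rintro l g γ g' γ' ⟨a, d, hptr, hown, hφ⟩ h
    exact ⟨a, d, hptr, h.owns o a d ho hown, hφ⟩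

/-- The new node `n` of a push is private to `t` and has the property `φ`. -/
abbrev privateNode (φ : Locals T Val → Node Val → Prop) : (elimProtocol env).Assertion t :=
  pointsTo env t (some t) (.inr rfl) Locals.n φ

/-- The node `oldTop` of a pop is public and has the property `φ`. -/
abbrev publicNode (φ : Locals T Val → Node Val → Prop) : (elimProtocol env).Assertion t :=
  pointsTo env t none (.inl rfl) Locals.oldTop φ

/-- `t` has popped the node `oldTop` and is bound to return its value. -/
def popped : (elimProtocol env).Assertion t where
  holds (l : Locals T Val) g γ :=
    ∃ v, (committed env t fun _ => v).holds l g γ ∧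
      (publicNode env t fun _ d => d.val = v).holds l g γ
  stable := by
    rintro l g γ g' γ' ⟨v, h₁, h₂⟩ h
    exact ⟨v, (committed env t _).stable h₁ h, (publicNode env t _).stable h₂ h⟩

/-- Another thread has collided with `t`, which is bound to return the value `r` of its local state
and its `location` cell. -/
def eliminated (r : Locals T Val → Option (Desc T Val) → Option Val) :
    (elimProtocol env).Assertion t where
  holds l (g : Shared T Val) γ :=
    γ.res t = some (r l (g.location t)) ∧ ∀ d, g.location t = some d → d.id ≠ t
  stable := by
    rintro l g γ g' γ' ⟨hres, hloc⟩ h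
    rcases h.slot with ⟨hres', hloc'⟩ | ⟨d, hd, hid, -⟩
    · exact ⟨hloc' ▸ hres'.trans hres, hloc' ▸ hloc⟩
    · exact absurd hid (hloc d hd)

/-- `t` has published its descriptor: either it is still there, and `t` has not been linearized, or
another thread has collided with `t`. -/
def awaiting : (elimProtocol env).Assertion t where
  holds (l : Locals T Val) (g : Shared T Val) γ :=
    (γ.res t = none ∧ g.location t = some l.p) ∨
      (eliminated env t fun l => received l.p.op).holds l g γ
  stable := by
    rintro l g γ g' γ' (⟨hres, hloc⟩ | hel) h
    · rcases h.slot with ⟨hres', hloc'⟩ | ⟨d, hd, -, hcol⟩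
      · exact .inl ⟨hres'.trans hres, hloc'.trans hloc⟩
      · cases hloc.symm.trans hd
        exact .inr hcol
    · exact .inr ((eliminated env t _).stable hel h)

end Assertions

section Treiber

open Protocol Assertion

variable {T : Type u} {Val : Type v} [DecidableEq T] {empty : Val} {env : Env (elimStack T empty)}
  {t : T}

variable (env t) in
theorem outline_malloc :
    (elimProtocol env).Outline t (unlinearized env t) (.act .malloc)
      (unlinearized env t ⊓ privateNode env t fun _ _ => True) := by
  refine outline_act ?_
  rintro l g γ _ _ hg - hP ⟨a, node, ha, rfl, rfl⟩
  have hne {o a' d} (h : Owns g γ o a' d) : a' ≠ a := by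
    rintro rfl
    cases ha.symm.trans h.2
  refine ⟨⟨γ.toHistory, Function.update γ.owner a (some t)⟩,
    ⟨rfl, rfl, fun _ _ => rfl, hg.waiting t, fun o a' d _ h =>
      ⟨(Function.update_of_ne (hne h) ..).trans h.1, (Function.update_of_ne (hne h) ..).trans h.2⟩⟩,
    ⟨hP, a, node, rfl, ⟨Function.update_self .., Function.update_self ..⟩, trivial⟩⟩

theorem outline_modifyNode {a : SAct} {φ ψ : Locals T Val → Node Val → Prop}
    {f : Locals T Val → Node Val → Node Val}
    (ha : ∀ l g l' g', sActSem a l g l' g' → l' = l ∧ g' = Shared.modifyNode g l.n (f l))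
    (hf : ∀ l d, (elimProtocol env).loc t l → φ l d → ψ l (f l d)) :
    (elimProtocol env).Outline t (unlinearized env t ⊓ privateNode env t φ) (.act a)
      (unlinearized env t ⊓ privateNode env t ψ) := by
  refine outline_act ?_
  rintro _ g γ l _ hg hl ⟨hP, b, d, hn, hown, hφ⟩ hexec
  obtain ⟨rfl, rfl⟩ := ha _ _ _ _ hexec
  change l.n = some b at hn
  rw [hn, Shared.modifyNode, hown.2]
  refine ⟨γ, ⟨rfl, rfl, fun _ _ => rfl, hg.waiting t, fun o a' d' ho h => ⟨h.1, ?_⟩⟩,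
    ⟨hP, b, f l d, hn, ⟨hown.1, Function.update_self ..⟩, hf l d hl hφ⟩⟩
  have hab : a' ≠ b := fun hab => ho (h.1.symm.trans (hab ▸ hown.1))
  exact (Function.update_of_ne hab ..).trans h.2

theorem linearize_self {g g' : Shared T Val} {γ : Ghost T Val} {l : Locals T Val} {r : Option Val}
    {s : List Val} {ℓ : Label (elimStack T empty)} {owner : ℕ → Option T}
    (hg : SharedInv env g γ) (hP : (unlinearized env t).holds l g γ)
    (hℓ : Linearizes env t l g γ.toHistory ℓ [t] (γ.lin t r)) (hloc : g'.location = g.location)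
    (hspares : Spares t g γ g' ⟨γ.lin t r, owner⟩) (hs : (γ.lin t r).Leaves env s)
    (hchain : Chain g' ⟨γ.lin t r, owner⟩ g'.top s) :
    SharedInv env g' ⟨γ.lin t r, owner⟩ ∧
      (elimProtocol env).guar t l g γ ℓ g' ⟨γ.lin t r, owner⟩ ∧
      g'.location t = none ∧ (γ.lin t r).res t = some r := by
  have hloc' : g'.location t = none := hloc ▸ hP.2
  have hres {u} (hu : u ≠ t) : (γ.lin t r).res u = γ.res u := Function.update_of_ne hu ..
  refine ⟨⟨fun u => ?_, s, hs, hchain⟩, ⟨⟨_, hℓ⟩, fun u hu => ?_⟩, hloc', Function.update_self ..⟩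
  · by_cases hu : u = t
    · exact waiting_of_location (by simp [hu, hloc'])
    · exact (hg.waiting u).congr (congrFun hloc u) (hres hu)
  · exact hspares.rely hu (.inl ⟨hres hu, congrFun hloc u⟩)

theorem outline_pushCAS {x : Val} (hx : Pushes env t x) :
    (elimProtocol env).Outline t
      (unlinearized env t ⊓ privateNode env t fun l d => d = ⟨some x, l.oldTop⟩)
      (.arw (.prim .topEqOld) .topToN) (committed env t fun _ => none) := by
  refine .arw ?_
  rintro _ g γ l _ hg - ⟨hP, a, _, hn, hown, rfl⟩ ⟨htop, rfl, rfl⟩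
  obtain ⟨s, hs, hchain⟩ := hg.stack
  change g.top = l.oldTop at htop
  have hspares : Spares t g γ { g with top := l.n }
      ⟨γ.lin t none, Function.update γ.owner a none⟩ := by
    refine fun o b d ho h => ⟨?_, h.2⟩
    have hba : b ≠ a := fun hba => ho (h.1.symm.trans (hba ▸ hown.1))
    exact (Function.update_of_ne hba ..).trans h.1
  refine ⟨_, linearize_self hg hP (.topCAS (.inl rfl)) rfl hspares (hs.push hP.1 hx) ?_⟩
  change Chain _ _ l.n _
  rw [hn]
  exact .cons ⟨Function.update_self .., hown.2⟩
    (htop ▸ hchain.mono fun b d => hspares none b d nofun)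

theorem outline_popCAS (hp : Pops env t) :
    (elimProtocol env).Outline t
      (unlinearized env t ⊓ publicNode env t fun l d => d.next = l.newTop)
      (.arw (.prim .topEqOld) .topToNew) (popped env t) := by
  refine .arw ?_
  rintro _ g γ l _ hg - ⟨hP, a, d, hptr, hown, hd⟩ ⟨htop, rfl, rfl⟩
  obtain ⟨s, hs, hchain⟩ := hg.stack
  rw [show g.top = some a from htop.trans hptr] at hchain
  cases hchain with | @cons _ x ptr s ha hchain
  cases hown.2.symm.trans ha.2
  subst hd
  have hspares : Spares t g γ { g with top := l.newTop } ⟨γ.lin t (some x), γ.owner⟩ :=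
    fun _ _ _ _ h => h
  obtain ⟨hinv, hguar, hloc⟩ := linearize_self (g' := { g with top := l.newTop }) hg hP
    (.topCAS (.inr rfl)) rfl hspares (hs.pop hP.1 hp)
    (hchain.mono fun b d => hspares none b d nofun)
  exact ⟨_, hinv, hguar, some x, hloc, a, _, hptr, hown, rfl⟩

theorem outline_readTop_pop (hp : Pops env t) :
    (elimProtocol env).Outline t (unlinearized env t) (.act .readTop)
      ((committed env t fun _ => some empty) ⊓ ofLocal (fun l : Locals T Val => l.oldTop = none) ⊔
        unlinearized env t ⊓ publicNode env t fun _ _ => True) := by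
  refine .act ?_
  rintro l _ γ _ g hg - hP ⟨rfl, rfl⟩
  obtain ⟨s, hs, hchain⟩ := hg.stack
  rcases htop : g.top with _ | a <;> rw [htop] at hchain
  · cases hchain
    have hspares : Spares t g γ g ⟨γ.lin t (some empty), γ.owner⟩ := fun _ _ _ _ h => h
    obtain ⟨hinv, hguar, hloc⟩ := linearize_self hg hP (.emptyRead hp htop) rfl hspares
      (hs.pop_nil hP.1 hp) (htop ▸ .nil)
    exact ⟨_, hinv, hguar, .inl ⟨hloc, rfl⟩⟩
  · cases hchain with | cons ha _
    exact ⟨γ, hg, (Frame.refl hg).guar id nofun, .inr ⟨hP, a, _, rfl, ha, trivial⟩⟩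

theorem outline_treiberIter_push {x : Val} (hx : Pushes env t x) :
    (elimProtocol env).Outline t (unlinearized env t) (treiberIter .push) (unlinearized env t) := by
  refine .seq (outline_malloc env t) <| .seq
    (Q := unlinearized env t ⊓ privateNode env t fun _ d => d.val = some x) ?setVal <| .seq
    (Q := unlinearized env t ⊓ privateNode env t fun _ d => d.val = some x) ?readTop <| .seq
    (Q := unlinearized env t ⊓ privateNode env t fun l d => d = ⟨some x, l.oldTop⟩) ?setNext <|
    .plus (.seq (outline_pushCAS hx) <| outline_ret ?ret) (outline_test ?failed)
  case setVal =>
    exact outline_modifyNode (fun _ _ _ _ h => h) fun _ _ hl _ =>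
      congrArg Desc.input (Option.some.inj (hl.2.symm.trans (descOf_of_pushes hx)))
  case readTop =>
    refine outline_act ?_
    rintro l g γ _ _ hg - hP ⟨rfl, rfl⟩
    exact ⟨γ, .refl hg, hP⟩
  case setNext =>
    refine outline_modifyNode (fun _ _ _ _ h => h) ?_
    rintro l ⟨v, ptr⟩ - rfl
    rfl
  case ret => exact fun _ _ _ _ h => h.2
  case failed => exact fun _ _ _ _ h _ => h.1

theorem outline_treiberIter_pop (hp : Pops env t) :
    (elimProtocol env).Outline t (unlinearized env t) (treiberIter .pop) (unlinearized env t) := by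
  refine .seq (outline_readTop_pop hp) <|
    .plus (.seq (Q := committed env t fun _ => some empty) (outline_test ?null) <|
      outline_ret ?ret) <|
    .seq (Q := unlinearized env t ⊓ publicNode env t fun _ _ => True) (outline_test ?nonempty) <|
    .seq (Q := unlinearized env t ⊓ publicNode env t fun l d => d.next = l.newTop)
      (outline_act ?readNext) <|
    .plus (.seq (outline_popCAS hp) <| .seq (Q := committed env t Locals.val)
      (outline_act ?readVal) <| outline_ret ?popRet) (outline_test ?failed)
  case null =>
    rintro l g γ - (⟨h, -⟩ | ⟨-, a, d, hptr, -⟩) hnull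
    · exact h
    · cases hptr.symm.trans hnull
  case ret => exact fun _ _ _ _ h => h.2
  case nonempty =>
    rintro l g γ - (⟨-, h⟩ | h) hnull
    · exact absurd h hnull
    · exact h
  case readNext =>
    rintro l g γ _ _ hg - ⟨hP, a, d, hptr, hown, -⟩ ⟨rfl, rfl⟩
    refine ⟨γ, .refl hg, hP, a, d, hptr, hown, ?_⟩
    rw [Shared.deref, hptr, Option.bind_some, hown.2, Option.bind_some]
  case readVal =>
    rintro l g γ _ _ hg - ⟨v, ⟨hloc, hres⟩, a, d, hptr, hown, rfl⟩ ⟨rfl, rfl⟩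
    refine ⟨γ, .refl hg, hloc, hres.trans (congrArg some ?_)⟩
    rw [Shared.deref, hptr, Option.bind_some, hown.2, Option.bind_some]
  case popRet => exact fun _ _ _ _ h => h.2
  case failed => exact fun _ _ _ _ h _ => h.1

end Treiber

section Elimination

open Protocol Assertion

variable {T : Type u} {Val : Type v} [DecidableEq T] {empty : Val} {env : Env (elimStack T empty)}
  {t : T} {Q : (elimProtocol env).Assertion t} {φ : Locals T Val → Prop}

theorem atomic_awaiting {ℓ : Label (elimStack T empty)}
    {exec : Locals T Val → Shared T Val → Locals T Val → Shared T Val → Prop}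
    (hℓ : ¬ IsLinCAS ℓ) (hret : ∀ r, ℓ ≠ .ret r)
    (h : ∀ l g l' g', exec l g l' g' →
      l'.p = l.p ∧ g'.top = g.top ∧ g'.heap = g.heap ∧ g'.location = g.location) :
    (elimProtocol env).Atomic t (awaiting env t) ℓ exec (awaiting env t) := by
  refine atomic_of_frame hℓ hret fun l g γ l' g' hg _ hP he => ?_
  obtain ⟨hp, htop, hheap, hloc⟩ := h _ _ _ _ he
  refine ⟨γ, ⟨htop, rfl, fun u _ => congrFun hloc u, (hg.waiting t).congr (congrFun hloc t) rfl,
    fun _ _ _ _ h => ⟨h.1, hheap ▸ h.2⟩⟩, ?_⟩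
  simpa only [awaiting, eliminated, hp, hloc] using hP

theorem outline_publish :
    (elimProtocol env).Outline t (unlinearized env t) (.act .publish) (awaiting env t) := by
  refine outline_act ?_
  rintro _ g γ l _ - hl hP ⟨rfl, rfl⟩
  have hloc : Function.update g.location (Locals.mytid l) (some l.p) t = some l.p := by
    rw [← hl.1, Function.update_self]
  refine ⟨γ, ⟨rfl, rfl, fun u hu => ?_, fun d hd _ => ?_, fun _ _ _ _ h => h⟩, .inl ⟨hP.1, hloc⟩⟩
  · exact Function.update_of_ne (hl.1 ▸ hu) ..
  · exact ⟨hl.2.trans (hloc.symm.trans hd), hP.1⟩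

theorem outline_announceCode :
    (elimProtocol env).Outline t (awaiting env t) announceCode (awaiting env t) := by
  have hread : (elimProtocol env).Outline t (awaiting env t) (.act .readCollision)
      (awaiting env t) :=
    .act <| atomic_awaiting id nofun fun _ _ _ _ ⟨hl, hg⟩ => hl ▸ hg ▸ ⟨rfl, rfl, rfl, rfl⟩
  refine hread.seq <| .seq (.star <| .seq (outline_test fun _ _ _ _ h _ => h) hread) <| .arw <|
    atomic_awaiting id nofun fun _ _ _ _ ⟨_, hl, hg⟩ => hl ▸ hg ▸ ⟨rfl, rfl, rfl, rfl⟩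

theorem outline_clearMine
    (hQ : ∀ l g γ, (unlinearized env t).holds l g γ → φ l → Q.holds l g γ) :
    (elimProtocol env).Outline t (awaiting env t ⊓ ofLocal φ) (.arw (.prim .mineEqP) .clearMine)
      Q := by
  refine .arw <| atomic_of_frame id nofun ?_
  rintro l g γ _ _ - ⟨rfl, hp⟩ ⟨hP, hφ⟩ ⟨hmine, rfl, rfl⟩
  refine ⟨γ, Frame.clear, hQ _ _ _ ⟨?_, Function.update_self ..⟩ hφ⟩
  rcases hP with ⟨hres, -⟩ | ⟨-, hid⟩
  · exact hres
  · exact absurd (id_of_descOf hp) (hid _ hmine)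

theorem outline_finish :
    (elimProtocol env).Outline t (awaiting env t ⊓ ofLocal φ)
      (.test (.not (.prim .mineEqP)) ⬝ finishCode) Q := by
  refine .seq (Q := eliminated env t fun l => received l.p.op) (outline_test ?failed) <|
    .seq (Q := eliminated env t fun l _ => l.val) (outline_act ?readMine) <|
    .seq (Q := committed env t Locals.val) (outline_act ?clearMine) <| outline_ret ?ret
  case failed =>
    rintro l g γ ⟨rfl, -⟩ ⟨⟨-, hloc⟩ | h, -⟩ hne
    · exact absurd hloc hne
    · exact h
  case readMine =>
    rintro l _ γ _ g hg ⟨rfl, -⟩ ⟨hres, hid⟩ ⟨rfl, rfl⟩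
    exact ⟨γ, .refl hg, hres.trans (congrArg some (pushPop_bind_input l _).symm), hid⟩
  case clearMine =>
    rintro l g γ _ _ - ⟨rfl, -⟩ ⟨hres, -⟩ ⟨rfl, rfl⟩
    exact ⟨γ, .clear, Function.update_self .., hres⟩
  case ret => exact fun _ _ _ _ h => h.2

theorem outline_clearCode :
    (elimProtocol env).Outline t (awaiting env t ⊓ ofLocal φ) clearCode (unlinearized env t) :=
  .plus (outline_clearMine fun _ _ _ h _ => h) outline_finish

/-- `t` has read the descriptor `q` of an invocation of `him` that it can eliminate. -/
def FoundPartner (l : Locals T Val) : Prop :=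
  ∃ q, l.q = some q ∧ l.him = some q.id ∧ l.p.op ≠ q.op

theorem exists_ghost_of_collision {g : Shared T Val} {γ : Ghost T Val} {l : Locals T Val}
    {b s₁ s₂ : T} {x : Val} {d : Desc T Val} {cell : Option (Desc T Val)} (hg : SharedInv env g γ)
    (hP : (unlinearized env t).holds l g γ) (hb : l.him = some b) (hd : g.location b = some d)
    (hid : d.id = b) (hs : s₁ = t ∧ s₂ = b ∨ s₁ = b ∧ s₂ = t) (h₁ : Pushes env s₁ x)
    (h₂ : Pops env s₂) (hcell : ∀ d', cell = some d' → d'.id ≠ b)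
    (hres : ((γ.lin s₁ none).lin s₂ (some x)).res b = some (received d.op cell)) :
    ∃ γ' : Ghost T Val, γ'.toHistory = (γ.lin s₁ none).lin s₂ (some x) ∧
      SharedInv env { g with location := Function.update g.location b cell } γ' ∧
      (elimProtocol env).guar t l g γ (.arw (.prim .himEqQ) .setHim)
        { g with location := Function.update g.location b cell } γ' := by
  obtain ⟨hrest, hloct⟩ : γ.res t = none ∧ g.location t = none := hP
  obtain ⟨-, hresb⟩ := hg.waiting b d hd hid
  have hbt : b ≠ t := by
    rintro rfl
    cases hd.symm.trans hloct
  have hne : s₂ ≠ s₁ := by grind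
  have hother {u} (hub : u ≠ b) (hut : u ≠ t) :
      ((γ.lin s₁ none).lin s₂ (some x)).res u = γ.res u := by
    simp only [History.lin, Function.update_apply]
    grind
  obtain ⟨s, hs', hchain⟩ := hg.stack
  refine ⟨⟨(γ.lin s₁ none).lin s₂ (some x), γ.owner⟩, rfl,
    ⟨fun u => ?_, s, ?_, hchain.mono fun _ _ h => h⟩,
    ⟨_, .collision hb (by simp [hd]) hs h₁ h₂⟩, fun u hut => ?_⟩
  · by_cases hub : u = b
    · exact waiting_of_location (by simpa [hub] using hcell)
    · by_cases hut : u = t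
      · exact waiting_of_location (by simp [hut, hbt.symm, hloct])
      · exact (hg.waiting u).congr (Function.update_of_ne hub ..) (hother hub hut)
  · exact hs'.push_pop (by grind) (by grind) hne h₁ h₂
  · by_cases hub : u = b
    · subst hub
      refine ⟨fun _ _ _ _ h => h, .inr ⟨d, hd, hid, ?_⟩⟩
      simpa [Collided] using ⟨hres, hcell⟩
    · exact ⟨fun _ _ _ _ h => h, .inl ⟨hother hub hut, Function.update_of_ne hub ..⟩⟩

theorem outline_setHim :
    (elimProtocol env).Outline t (unlinearized env t ⊓ ofLocal FoundPartner)
      (.arw (.prim .himEqQ) .setHim) (committed env t fun l => received l.p.op l.q) := by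
  refine .arw ?_
  rintro _ g γ l _ hg ⟨-, hp⟩ ⟨hP, d, hq, hhim, hop⟩ ⟨heq, rfl, b, hb, rfl⟩
  obtain rfl : d.id = b := Option.some.inj (hhim.symm.trans hb)
  have hd : g.location d.id = some d := by rw [← hq, ← heq, hhim, Option.bind_some]
  have hne : t ≠ d.id := by
    intro h
    cases hP.2.symm.trans (h ▸ hd)
  have hcell : ∀ d', l.pushPop (some l.p) none = some d' → d'.id ≠ d.id := by
    unfold Locals.pushPop
    have := id_of_descOf hp
    grind
  obtain ⟨s₁, s₂, x, hs, h₁, h₂, hres, hrest⟩ : ∃ (s₁ s₂ : T) (x : Val),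
      (s₁ = t ∧ s₂ = d.id ∨ s₁ = d.id ∧ s₂ = t) ∧ Pushes env s₁ x ∧ Pops env s₂ ∧
        ((γ.lin s₁ none).lin s₂ (some x)).res d.id =
          some (received d.op (l.pushPop (some l.p) none)) ∧
        ((γ.lin s₁ none).lin s₂ (some x)).res t = some (received l.p.op l.q) := by
    obtain ⟨x, h₁, hx⟩ | ⟨h₂, hx⟩ := descOf_eq_some hp <;>
      obtain ⟨y, h₁', hy⟩ | ⟨h₂', hy⟩ := descOf_eq_some (hg.waiting _ d hd rfl).1 <;>
      simp only [congrArg Desc.op hy, hx, ne_eq, not_true_eq_false] at hop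
    · exact ⟨t, d.id, x, .inl ⟨rfl, rfl⟩, h₁, h₂', by
        simp [History.lin, received, Locals.pushPop, hx, congrArg Desc.op hy], by
        simp [History.lin, received, hx, hne]⟩
    · exact ⟨d.id, t, y, .inr ⟨rfl, rfl⟩, h₁', h₂, by
        simp [History.lin, received, hne.symm, congrArg Desc.op hy], by
        simp [History.lin, received, hx, hq, congrArg Desc.input hy]⟩
  obtain ⟨γ', hγ', hg', hguar⟩ := exists_ghost_of_collision hg hP hb hd rfl hs h₁ h₂ hcell hres
  refine ⟨γ', hg', hguar, ?_, (congrArg (History.res · t) hγ').trans hrest⟩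
  exact (Function.update_of_ne hne ..).trans hP.2

theorem outline_collideCode :
    (elimProtocol env).Outline t (awaiting env t ⊓ ofLocal FoundPartner) collideCode
      (unlinearized env t) :=
  .plus
    (.seq (Q := unlinearized env t ⊓ ofLocal FoundPartner)
      (outline_clearMine fun _ _ _ h hφ => ⟨h, hφ⟩) <|
      .plus
        (.seq outline_setHim <|
          outline_ret fun l _ _ _ h => h.2.trans (congrArg some (pushPop_bind_input l _).symm))
        (outline_test fun _ _ _ _ h _ => h.1))
    outline_finish

theorem outline_eliminationIter :
    (elimProtocol env).Outline t (unlinearized env t) eliminationIter (unlinearized env t) := by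
  have hclear (b : BExp STest) : (elimProtocol env).Outline t (awaiting env t)
      (.test b ⬝ clearCode) (unlinearized env t) :=
    .seq (Q := awaiting env t ⊓ ofLocal fun _ => True)
      (outline_test fun _ _ _ _ h _ => ⟨h, trivial⟩) outline_clearCode
  refine .seq outline_publish <| .seq (.act (atomic_awaiting id nofun ?choosePos)) <|
    .seq outline_announceCode <| .plus
      (.seq (outline_test fun _ _ _ _ h _ => h) <|
        .seq (.act (atomic_awaiting id nofun ?readHim)) <|
          .plus (.seq (outline_test ?canCollide) outline_collideCode) (hclear _))
      (hclear _)
  case choosePos =>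
    rintro l g _ _ ⟨⟨i, rfl⟩, rfl⟩
    exact ⟨rfl, rfl, rfl, rfl⟩
  case readHim =>
    rintro l g _ _ ⟨rfl, rfl⟩
    exact ⟨rfl, rfl, rfl, rfl⟩
  case canCollide =>
    rintro l g γ - h ⟨-, ⟨d, hd, hhim⟩, d', hd', hop⟩
    cases hd.symm.trans hd'
    exact ⟨h, d, hd, hhim, hop⟩

theorem elimProtocol_verifies : (elimProtocol env).Verifies env := by
  intro t m x he
  refine ⟨⟨rfl, by rw [descOf, he]; rfl⟩, _, _, fun _ _ h => h,
    .star (.seq ?_ outline_eliminationIter)⟩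
  cases m with
  | push => exact outline_treiberIter_push he
  | pop => exact outline_treiberIter_pop he

end Elimination

/-! ### Linearization points -/

section LinearizationPoints

variable {T : Type u} {Val : Type v} [DecidableEq T] {empty : Val} {env : Env (elimStack T empty)}

namespace Linearizes

variable {t u : T} {l : Locals T Val} {g : Shared T Val} {H H' : History T Val} {new : List T}
  {ℓ : Label (elimStack T empty)}

theorem ts_eq (h : Linearizes env t l g H ℓ new H') : H'.ts = H.ts ++ new := by
  cases h <;> simp only [History.lin, List.append_nil, List.append_assoc, List.cons_append,
    List.nil_append]

theorem res_eq (h : Linearizes env t l g H ℓ new H') (hu : u ∉ new) : H'.res u = H.res u := by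
  cases h <;> simp_all [History.lin]

theorem res_of_ret {r : Option Val} (h : Linearizes env t l g H (.ret r) new H') :
    H.res t = some r := by
  cases h with
  | silent _ hret => exact hret r rfl

theorem mem_of_topCAS {a : SAct} (h : Linearizes env t l g H (.arw (.prim .topEqOld) a) new H')
    (ha : a = .topToN ∨ a = .topToNew) : t ∈ new := by
  cases h with
  | silent hℓ => rcases ha with rfl | rfl <;> exact absurd trivial hℓ
  | topCAS => exact List.mem_singleton_self t

theorem eq_of_setHim (h : Linearizes env t l g H (.arw (.prim .himEqQ) .setHim) new H') :
    ∃ b s₁ s₂ x, l.him = some b ∧ new = [s₁, s₂] ∧ (s₁ = t ∧ s₂ = b ∨ s₁ = b ∧ s₂ = t) ∧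
      Pushes env s₁ x ∧ Pops env s₂ := by
  cases h with
  | silent hℓ => exact absurd trivial hℓ
  | collision hb _ hs h₁ h₂ => exact ⟨_, _, _, _, hb, rfl, hs, h₁, h₂⟩

theorem of_mem (h : Linearizes env t l g H ℓ new H') (hu : u ∈ new) :
    (u = t ∧ ∃ a, (a = .topToN ∨ a = .topToNew) ∧ ℓ = .arw (.prim .topEqOld) a) ∨
    (u = t ∧ ℓ = .act .readTop ∧ g.top = none ∧ Pops env t ∧ H'.res t = some (some empty)) ∨
    ∃ b, ℓ = .arw (.prim .himEqQ) .setHim ∧ l.him = some b ∧ g.location b ≠ none ∧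
      (u = t ∨ u = b) := by
  cases h with
  | silent => cases hu
  | topCAS ha => exact .inl ⟨List.mem_singleton.1 hu, _, ha, rfl⟩
  | emptyRead ht htop =>
    exact .inr (.inl ⟨List.mem_singleton.1 hu, rfl, htop, ht, Function.update_self ..⟩)
  | collision hb hloc hs => exact .inr (.inr ⟨_, rfl, hb, hloc, by grind⟩)

end Linearizes

/-- `γ i` is an auxiliary state for the `i`-th configuration of `ρ`, and `batch i` is the list of
the threads that the `i`-th step linearizes. The local state `l` is irrelevant for invocations. -/
structure IsAnnotation (ρ : Execution (elimStack T empty) env) (γ : ℕ → Ghost T Val)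
    (batch : ℕ → List T) : Prop where
  init : (γ 0).ts = []
  holds : ∀ i ≤ ρ.trace.length, (elimProtocol env).Holds (ρ.conf i) (γ i)
  step : ∀ i t ℓ, ρ.trace[i]? = some (t, ℓ) → ∃ l : Locals T Val,
    ((∃ m x, ℓ = .inv m x) ∨ ∃ k, (ρ.conf i).thr t = some (l, k)) ∧
      Linearizes env t l (ρ.conf i).gl (γ i).toHistory ℓ (batch i) (γ (i + 1)).toHistory

theorem exists_isAnnotation (ρ : Execution (elimStack T empty) env) :
    ∃ γ batch, IsAnnotation ρ γ batch := by
  have h₀ : (elimProtocol env).Holds (Config.init _) ⟨⟨[], fun _ => none⟩, fun _ => none⟩ :=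
    ⟨⟨fun _ => waiting_of_location nofun, [], History.leaves_nil, .nil⟩, fun _ => ⟨rfl, rfl⟩⟩
  obtain ⟨γ, hinit, hholds, hallows⟩ :=
    Protocol.exists_auxiliary_states elimProtocol_verifies ρ h₀
  have hstep : ∀ i, ∃ new, ∀ t ℓ, ρ.trace[i]? = some (t, ℓ) → ∃ l : Locals T Val,
      ((∃ m x, ℓ = .inv m x) ∨ ∃ k, (ρ.conf i).thr t = some (l, k)) ∧
        Linearizes env t l (ρ.conf i).gl (γ i).toHistory ℓ new (γ (i + 1)).toHistory := by
    intro i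
    rcases htℓ : ρ.trace[i]? with _ | ⟨t, ℓ⟩
    · exact ⟨[], nofun⟩
    rcases hallows i t ℓ htℓ with ⟨m, x, rfl, hγ⟩ | ⟨l, k, hk, ⟨new, hlin⟩, -⟩
    · refine ⟨[], ?_⟩
      rintro _ _ ⟨⟩
      exact ⟨(elimStack T empty).initLo t m x, .inl ⟨m, x, rfl⟩, hγ ▸ .silent id nofun⟩
    · refine ⟨new, ?_⟩
      rintro _ _ ⟨⟩
      exact ⟨l, .inr ⟨k, hk⟩, hlin⟩
  choose batch hbatch using hstep
  exact ⟨γ, batch, congrArg (·.ts) hinit, hholds, hbatch⟩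

namespace IsAnnotation

variable {ρ : Execution (elimStack T empty) env} {γ : ℕ → Ghost T Val} {batch : ℕ → List T}
  {i j k : ℕ} {t a b : T} {r : Option Val}

theorem exists_step (h : IsAnnotation ρ γ batch) (hi : i < ρ.trace.length) :
    ∃ t ℓ l, ρ.trace[i]? = some (t, ℓ) ∧
      ((∃ m x, ℓ = .inv m x) ∨ ∃ k, (ρ.conf i).thr t = some (l, k)) ∧
      Linearizes env t l (ρ.conf i).gl (γ i).toHistory ℓ (batch i) (γ (i + 1)).toHistory := by
  obtain ⟨t, ℓ, htℓ, -⟩ := ρ.exists_trans hi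
  obtain ⟨l, hlin⟩ := h.step i t ℓ htℓ
  exact ⟨t, ℓ, l, htℓ, hlin⟩

theorem ts_eq (h : IsAnnotation ρ γ batch) (hi : i ≤ ρ.trace.length) :
    (γ i).ts = linOrder batch i := by
  induction i with
  | zero => exact h.init
  | succ i ih =>
    obtain ⟨_, _, _, -, -, hlin⟩ := h.exists_step hi
    rw [hlin.ts_eq, ih (Nat.le_of_succ_le hi), linOrder_succ]

theorem res_mono (h : IsAnnotation ρ γ batch) (hij : i ≤ j) (hj : j ≤ ρ.trace.length)
    (hr : (γ i).res t = some r) : (γ j).res t = some r := by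
  induction j, hij using Nat.le_induction with
  | base => exact hr
  | succ j _ ih =>
    have ih := ih (Nat.le_of_succ_le hj)
    obtain ⟨_, _, _, -, -, hlin⟩ := h.exists_step hj
    obtain ⟨s, hs, -⟩ := (h.holds j (Nat.le_of_succ_le hj)).inv.stack
    obtain ⟨s', hs', -⟩ := (h.holds (j + 1) hj).inv.stack
    have hmem : t ∈ (γ j).ts := (hs.mem_iff t).2 (by simp [ih])
    rw [hlin.res_eq (List.disjoint_of_nodup_append (hlin.ts_eq ▸ hs'.nodup) hmem), ih]

theorem isSchedule (h : IsAnnotation ρ γ batch) :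
    IsSchedule ρ batch (γ ρ.trace.length).res where
  nodup := by
    obtain ⟨s, hs, -⟩ := (h.holds _ le_rfl).inv.stack
    exact h.ts_eq le_rfl ▸ hs.nodup
  invoked i hi u hu hnone := by
    obtain ⟨t, ℓ, l, -, hl, hlin⟩ := h.exists_step hi
    have hidle := (h.holds i hi.le).thr u
    rw [hnone] at hidle
    rcases hlin.of_mem hu with ⟨rfl, _, _, rfl⟩ | ⟨rfl, rfl, -⟩ | ⟨b, rfl, -, hloc, rfl | rfl⟩
    · simp [hnone] at hl
    · simp [hnone] at hl
    · simp [hnone] at hl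
    · exact hloc hidle.2
  returned j t r hj := by
    have hlt := (List.getElem?_eq_some_iff.1 hj).1
    obtain ⟨l, -, hlin⟩ := h.step _ _ _ hj
    obtain ⟨s, hs, -⟩ := (h.holds j hlt.le).inv.stack
    refine ⟨h.res_mono hlt.le le_rfl hlin.res_of_ret, mem_linOrder.1 ?_⟩
    exact h.ts_eq hlt.le ▸ (hs.mem_iff t).2 (by simp [hlin.res_of_ret])

theorem isLinearization (h : IsAnnotation ρ γ batch) (hρ : ρ.Completed) :
    IsLinearization (stackSpec empty) ρ.trace (linPoint batch)
      (linOrder batch ρ.trace.length) := by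
  obtain ⟨s, hs, -⟩ := (h.holds _ le_rfl).inv.stack
  obtain ⟨os, hos, hleads⟩ := hs.spec
  have hrun : os ∈ stackSpec empty := List.append_nil os ▸ hleads [] trivial
  exact h.isSchedule.isLinearization hρ hrun (h.ts_eq le_rfl ▸ hos)

theorem cases_of_mem_batch (h : IsAnnotation ρ γ batch) (hρ : ρ.Completed)
    (hk : k < ρ.trace.length) (ht : t ∈ batch k) :
    TopCASAt ρ k t ∨ EmptyReadAt ρ k t ∨ ∃ a b, CollisionAt ρ k a b ∧ (t = a ∨ t = b) := by
  obtain ⟨u, ℓ, l, hstep, hl, hlin⟩ := h.exists_step hk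
  rcases hlin.of_mem ht with ⟨rfl, a, rfl | rfl, rfl⟩ | ⟨rfl, rfl, htop, hpop, hres⟩ |
    ⟨b, rfl, hb, -, hub⟩
  · exact .inl (.inl hstep)
  · exact .inl (.inr hstep)
  · refine .inr (.inl ⟨h.isSchedule.operationOf hρ (mem_linOrder.2 ⟨k, hk, ht⟩) hpop ?_,
      hstep, htop⟩)
    exact h.res_mono hk le_rfl hres
  · obtain ⟨_, _, ⟨⟩⟩ | ⟨c, hc⟩ := hl
    exact .inr (.inr ⟨u, b, ⟨hstep, l, c, hc, hb⟩, hub⟩)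

theorem mem_batch_of_topCASAt (h : IsAnnotation ρ γ batch) (hk : TopCASAt ρ k t) :
    k < ρ.trace.length ∧ t ∈ batch k := by
  rcases hk with hk | hk <;> obtain ⟨l, -, hlin⟩ := h.step _ _ _ hk
  · exact ⟨(List.getElem?_eq_some_iff.1 hk).1, hlin.mem_of_topCAS (.inl rfl)⟩
  · exact ⟨(List.getElem?_eq_some_iff.1 hk).1, hlin.mem_of_topCAS (.inr rfl)⟩

theorem batch_of_collisionAt (h : IsAnnotation ρ γ batch) (hk : CollisionAt ρ k a b) :
    k < ρ.trace.length ∧ ∃ s₁ s₂ x, batch k = [s₁, s₂] ∧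
      (s₁ = a ∧ s₂ = b ∨ s₁ = b ∧ s₂ = a) ∧ Pushes env s₁ x ∧ Pops env s₂ := by
  obtain ⟨hstep, l, c, hc, hb⟩ := hk
  obtain ⟨l', ⟨_, _, ⟨⟩⟩ | ⟨c', hc'⟩, hlin⟩ := h.step _ _ _ hstep
  cases hc.symm.trans hc'
  obtain ⟨b', s₁, s₂, x, hb', hbatch, hs, h₁, h₂⟩ := hlin.eq_of_setHim
  cases hb.symm.trans hb'
  exact ⟨(List.getElem?_eq_some_iff.1 hstep).1, s₁, s₂, x, hbatch, hs, h₁, h₂⟩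

theorem invokes (h : IsAnnotation ρ γ batch) (hk : k < ρ.trace.length) (ht : t ∈ batch k)
    {m : StackMeth} {x : StackArg Val m} (he : env t = some ⟨m, x⟩) : Invokes ρ t m := by
  obtain ⟨i, -, m', x', he', hi⟩ := ρ.exists_inv hk.le (h.isSchedule.invoked k hk t ht)
  cases he.symm.trans he'
  exact ⟨x, List.mem_of_getElem? hi⟩

theorem hasElimLinPoints (h : IsAnnotation ρ γ batch) (hρ : ρ.Completed) :
    HasElimLinPoints ρ (linPoint batch) (linOrder batch ρ.trace.length) where
  cases t ht := by
    obtain ⟨k, hk, htk⟩ := mem_linOrder.1 ht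
    exact (h.isSchedule.linPoint_eq hk htk).symm ▸ h.cases_of_mem_batch hρ hk htk
  topCAS k t hk := by
    obtain ⟨hlt, ht⟩ := h.mem_batch_of_topCASAt hk
    exact h.isSchedule.linPoint_eq hlt ht
  collision k a b hk := by
    obtain ⟨hlt, s₁, s₂, x, hbatch, hs, h₁, h₂⟩ := h.batch_of_collisionAt hk
    obtain ⟨ts, hts⟩ := exists_linOrder_eq_append (batch := batch) hlt
    refine ⟨h.isSchedule.linPoint_eq hlt ?_, h.isSchedule.linPoint_eq hlt ?_, s₁, s₂, hs,
      h.invokes hlt ?_ h₁, h.invokes hlt ?_ h₂, linOrder batch k, ts, by rw [hts, hbatch]; rfl⟩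
    all_goals grind

end IsAnnotation

end LinearizationPoints

end KatObj

theorem mainTheorem8 {T : Type*} [DecidableEq T] {Val : Type*} (empty : Val) :
    KatObj.Linearizable (KatObj.elimStack T empty) (KatObj.stackSpec empty) ∧
    ∀ (env : KatObj.Env (KatObj.elimStack T empty))
      (ρ : KatObj.Execution (KatObj.elimStack T empty) env), ρ.Completed →
      ∃ (lp : T → ℕ) (ts : List T),
        KatObj.IsLinearization (KatObj.stackSpec empty) ρ.trace lp ts ∧
        KatObj.HasElimLinPoints ρ lp ts := by
  have hlin (env : KatObj.Env (KatObj.elimStack T empty))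
      (ρ : KatObj.Execution (KatObj.elimStack T empty) env) (hρ : ρ.Completed) :
      ∃ lp ts, KatObj.IsLinearization (KatObj.stackSpec empty) ρ.trace lp ts ∧
        KatObj.HasElimLinPoints ρ lp ts := by
    obtain ⟨γ, batch, h⟩ := KatObj.exists_isAnnotation ρ
    exact ⟨_, _, h.isLinearization hρ, h.hasElimLinPoints hρ⟩
  refine ⟨?_, hlin⟩
  rintro τ ⟨env, ρ, hρ, rfl⟩
  obtain ⟨lp, ts, h, -⟩ := hlin env ρ hρ
  exact ⟨lp, ts, h⟩
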